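/- **Setting.** An instance consists of a law of an individual $(X,A,Y)$ (features, group in a finite set $\mathcal A$, true label $Y\in\{0,1\}$) and a classifier $f(X,A)\in\{0,1\}$. Write $\beta_a=\mathbb P[f=0\mid A=a]$, $q_{y\mid a}=\mathbb P[Y=y\mid A=a]$, $p_{y\mid a}=\mathbb P[f=1,Y=y\mid A=a]$, and let $\Delta=\max_y\max_{a,a'}\bigl|\mathbb P[f=1\mid Y=y,A=a]-\mathbb P[f=1\mid Y=y,A=a']\bigr|$ be the equalized odds difference. A (randomized, adaptive) auditor meets i.i.d. individuals one after the other. In each round it sees $X,A,f(X,A)$; if $f=1$ it also sees $Y$; if $f=0$ it sees $Y$ only if it requests the true label. It may stop at any time and announce FAIR or UNFAIR. Its running time is the number of rounds. It succeeds in the $(\varepsilon,\delta)$-fairness audit on an instance if with probability at least $1-\delta$ it announces FAIR when $\Delta=0$, and UNFAIR when $\Delta>\varepsilon$. Put $\Lambda(\delta)=(1-2\delta)\log\frac{1-\delta}{\delta}$ for $\delta<1/2$ and $\Lambda(\delta)=0$ for $\delta\ge 1/2$ (so $\Lambda(\delta)\ge\log\frac1{4\delta}$ for $\delta<1/2$).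 **Theorem (lower bound).** There is a universal constant $c>0$ such that for all $\varepsilon\in(0,1/4)$ and $\delta\in(0,1)$ the following holds. Let $\mathcal A=\{0,1\}$, $y_0\in\{0,1\}$, $w,s\in(0,1)$, and let $r_0,r_1>0$ satisfy $(1-s)(1-r_a)\ge\max\{\tfrac12,8\varepsilon\}\,r_a$ for $a=0,1$. Then there are instances $F,U_0,U_1$ with the same classifier, binary features, and $\mathbb P[A=1]=w$, such that * $F$ is fair ($\Delta=0$), with $q_{y_0\mid a}=r_a$, $p_{y_0\mid a}=r_a/2$, $p_{1-y_0\mid a}=s(1-r_a)$, $\beta_a=1-r_a/2-s(1-r_a)$ for $a=0,1$; * for $b=0,1$, $U_b$ is unfair ($\Delta>\varepsilon$) and has the same $p_{y\mid a}$, $\beta_a$ as $F$ for all $y,a$, and the same $q_{y\mid a}$ except that $q_{y_0\mid b}=r_b(1+4\varepsilon)$; and every auditor that has finite expected running time and succeeds in the $(\varepsilon,\delta)$-fairness audit on $F,U_0,U_1$ requests in expectation * at least $c\,\Lambda(\delta)\sum_{a}\sum_{y}\frac{\beta_a}{q_{y\mid a}\varepsilon^2}$ true labels on $F$; * at least $c\,\Lambda(\delta)\sum_{y}\frac{\beta_b}{q_{y\mid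 b}\varepsilon^2}$ true labels on $U_b$, for $b=0,1$, and, if $r_0=r_1$, even at least $c\,\Lambda(\delta)\sum_{a}\sum_{y}\frac{\beta_a}{q_{y\mid a}\varepsilon^2}$ true labels on $U_b$ (where $\beta_a$, $q_{y\mid a}$ are those of the instance in question). -/

import Mathlib

open MeasureTheory ProbabilityTheory
open scoped ENNReal

namespace FairnessAudit

universe u

/-- A problem instance: the law of an individual `(X, A, Y)` (features, group, true label) and
the classifier under audit. `true` stands for the label / decision `1`, `false` for `0`. -/
structure AuditInstance (X A : Type*) [MeasurableSpace X] [MeasurableSpace A] where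
  law : Measure (X × A × Bool)
  isProb : IsProbabilityMeasure law
  classifier : X × A → Bool
  measurable_classifier : Measurable classifier

attribute [instance] AuditInstance.isProb

namespace AuditInstance

variable {X A : Type*} [MeasurableSpace X] [MeasurableSpace A]

/-- The event `A = a`. -/
def groupEvent (_I : AuditInstance X A) (a : A) : Set (X × A × Bool) := {z | z.2.1 = a}

/-- The event `Y = y`. -/
def labelEvent (_I : AuditInstance X A) (y : Bool) : Set (X × A × Bool) := {z | z.2.2 = y}

/-- The event `f(X, A) = b`. -/
def decisionEvent (I : AuditInstance X A) (b : Bool) : Set (X × A × Bool) :=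
  {z | I.classifier (z.1, z.2.1) = b}

/-- `ℙ[A = a]`. -/
noncomputable def groupProb (I : AuditInstance X A) (a : A) : ℝ := I.law.real (I.groupEvent a)

/-- `β_a = ℙ[f = 0 ∣ A = a]`. -/
noncomputable def beta (I : AuditInstance X A) (a : A) : ℝ :=
  (cond I.law (I.groupEvent a)).real (I.decisionEvent false)

/-- `q_{y∣a} = ℙ[Y = y ∣ A = a]`. -/
noncomputable def q (I : AuditInstance X A) (y : Bool) (a : A) : ℝ :=
  (cond I.law (I.groupEvent a)).real (I.labelEvent y)

/-- `p_{y∣a} = ℙ[f = 1, Y = y ∣ A = a]`. -/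
noncomputable def p (I : AuditInstance X A) (y : Bool) (a : A) : ℝ :=
  (cond I.law (I.groupEvent a)).real (I.decisionEvent true ∩ I.labelEvent y)

/-- `ℙ[f = 1 ∣ Y = y, A = a]`. -/
noncomputable def positiveRate (I : AuditInstance X A) (y : Bool) (a : A) : ℝ :=
  (cond I.law (I.labelEvent y ∩ I.groupEvent a)).real (I.decisionEvent true)

/-- The equalized odds difference
`Δ = max_y max_{a,a'} |ℙ[f = 1 ∣ Y = y, A = a] - ℙ[f = 1 ∣ Y = y, A = a']|`
(the set of groups is finite, so the suprema are maxima). -/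
noncomputable def eod [Finite A] (I : AuditInstance X A) : ℝ :=
  ⨆ y : Bool, ⨆ a : A, ⨆ a' : A, |I.positiveRate y a - I.positiveRate y a'|

/-- `Σ_y β_a / (q_{y∣a} ε²)`, the share of the group `a` in the label complexity. -/
noncomputable def groupComplexity (I : AuditInstance X A) (ε : ℝ) (a : A) : ℝ :=
  ∑ y : Bool, I.beta a / (I.q y a * ε ^ 2)

/-- `Σ_a Σ_y β_a / (q_{y∣a} ε²)`. -/
noncomputable def labelComplexity [Fintype A] (I : AuditInstance X A) (ε : ℝ) : ℝ :=
  ∑ a : A, I.groupComplexity ε a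

end AuditInstance

/-- What the auditor learns about a true label: its value, or nothing (`star`). -/
inductive Feedback where
  | star : Feedback
  | label (y : Bool) : Feedback

instance : MeasurableSpace Feedback := ⊤

/-- The two possible conclusions of an audit. -/
inductive Verdict where
  | fair : Verdict
  | unfair : Verdict

instance : MeasurableSpace Verdict := ⊤

/-- The record of one round: features, group, decision of the classifier, label feedback. -/
abbrev Observation (X A : Type*) := X × A × Bool × Feedback

/-- A randomized, adaptive auditor. After `t` rounds it knows its internal random seed and the
records of these rounds; it then either stops and announces a verdict, or lets the next individual
arrive. When that individual is classified negatively, the auditor decides, from everything it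
knows and from the features and the group of the individual, whether to request the true label. -/
structure Auditor (X A : Type*) [MeasurableSpace X] [MeasurableSpace A] where
  Seed : Type u
  [measurableSeed : MeasurableSpace Seed]
  seedLaw : Measure Seed
  isProb : IsProbabilityMeasure seedLaw
  halt : (t : ℕ) → Seed × (Fin t → Observation X A) → Bool
  verdict : (t : ℕ) → Seed × (Fin t → Observation X A) → Verdict
  request : (t : ℕ) → Seed × (Fin t → Observation X A) × X × A → Bool
  measurable_halt : ∀ t, Measurable (halt t)
  measurable_verdict : ∀ t, Measurable (verdict t)
  measurable_request : ∀ t, Measurable (request t)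

attribute [instance] Auditor.measurableSeed Auditor.isProb

namespace Auditor

variable {X A : Type*} [MeasurableSpace X] [MeasurableSpace A]

/-- The sample space of a run: the seed of the auditor and the stream of individuals. -/
abbrev Run (π : Auditor.{u} X A) := π.Seed × (ℕ → X × A × Bool)

/-- The law of a run on the instance `I`: the individuals are independent with law `I.law`, and
they are independent of the seed. -/
noncomputable def runLaw (π : Auditor.{u} X A) (I : AuditInstance X A) : Measure π.Run :=
  π.seedLaw.prod (Measure.infinitePi fun _ : ℕ => I.law)

open Classical in
/-- The record of a round in which the individual `z` arrives after the history `h`. The label of a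
positively classified individual is revealed without a request. -/
noncomputable def observe (π : Auditor.{u} X A) (I : AuditInstance X A) (s : π.Seed) (t : ℕ)
    (h : Fin t → Observation X A) (z : X × A × Bool) : Observation X A :=
  (z.1, z.2.1, I.classifier (z.1, z.2.1),
    if I.classifier (z.1, z.2.1) = true ∨ π.request t (s, h, z.1, z.2.1) = true
    then Feedback.label z.2.2 else Feedback.star)

/-- The records of the first `t` rounds (computed as if the auditor did not stop before). -/
noncomputable def history (π : Auditor.{u} X A) (I : AuditInstance X A) (ω : π.Run) :
    (t : ℕ) → Fin t → Observation X A
  | 0 => Fin.elim0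
  | t + 1 => Fin.snoc (π.history I ω t) (π.observe I ω.1 t (π.history I ω t) (ω.2 t))

/-- The auditor stops after `t` rounds unless it has stopped before. -/
def haltsAt (π : Auditor.{u} X A) (I : AuditInstance X A) (ω : π.Run) (t : ℕ) : Prop :=
  π.halt t (ω.1, π.history I ω t) = true

/-- The running time: the number of rounds before the auditor stops (`⊤` if it never does). -/
noncomputable def runningTime (π : Auditor.{u} X A) (I : AuditInstance X A) (ω : π.Run) : ℕ∞ :=
  ⨅ t : {t : ℕ // π.haltsAt I ω t}, ((t : ℕ) : ℕ∞)

/-- The auditor stops and announces `v`. -/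
def announces (π : Auditor.{u} X A) (I : AuditInstance X A) (v : Verdict) (ω : π.Run) : Prop :=
  ∃ t : ℕ, π.runningTime I ω = t ∧ π.verdict t (ω.1, π.history I ω t) = v

/-- In the round with index `t` (counted from `0`) the auditor is still active, the individual is
classified negatively, and the auditor requests its true label. -/
def requestsLabel (π : Auditor.{u} X A) (I : AuditInstance X A) (ω : π.Run) (t : ℕ) : Prop :=
  (t : ℕ∞) < π.runningTime I ω ∧ I.classifier ((ω.2 t).1, (ω.2 t).2.1) = false ∧
    π.request t (ω.1, π.history I ω t, (ω.2 t).1, (ω.2 t).2.1) = true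

open Classical in
/-- The number of true labels requested during the run. -/
noncomputable def labelCount (π : Auditor.{u} X A) (I : AuditInstance X A) (ω : π.Run) : ℝ≥0∞ :=
  ∑' t : ℕ, if π.requestsLabel I ω t then 1 else 0

/-- The expected number of true labels requested on the instance `I`. -/
noncomputable def expectedLabels (π : Auditor.{u} X A) (I : AuditInstance X A) : ℝ≥0∞ :=
  ∫⁻ ω, π.labelCount I ω ∂(π.runLaw I)

/-- The expected running time on the instance `I`. -/
noncomputable def expectedTime (π : Auditor.{u} X A) (I : AuditInstance X A) : ℝ≥0∞ :=
  ∫⁻ ω, (π.runningTime I ω : ℝ≥0∞) ∂(π.runLaw I)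

/-- On the instance `I` the auditor identifies the true hypothesis among `Δ = 0` and `Δ > ε`
with probability at least `1 - δ`. -/
def SucceedsOn [Finite A] (π : Auditor.{u} X A) (I : AuditInstance X A) (ε δ : ℝ) : Prop :=
  (I.eod = 0 → ENNReal.ofReal (1 - δ) ≤ π.runLaw I {ω | π.announces I Verdict.fair ω}) ∧
  (ε < I.eod → ENNReal.ofReal (1 - δ) ≤ π.runLaw I {ω | π.announces I Verdict.unfair ω})

end Auditor

/-- The dependence on the confidence: `(1 - 2δ) log((1 - δ)/δ)` for `δ < 1/2`, and `0` for
`δ ≥ 1/2`. It is of the order of `log (1/δ)` as `δ` tends to `0`, and at least `log (1/(4δ))` for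
every `δ ∈ (0, 1/2)`. -/
noncomputable def confidenceFactor (δ : ℝ) : ℝ := max (1 - 2 * δ) 0 * Real.log ((1 - δ) / δ)

end FairnessAudit

namespace FairnessAudit

/-! The proof is a change of measure. All instances share the classifier and the law of `(X, A)`,
and they agree on positively classified individuals; `U b` differs from `F` only in the law of the
label among negatively classified individuals of group `b`. So the records distinguish `F` from `U
b` only through labels requested in group `b`, and one such label carries little information. In
that cell the label is a Bernoulli variable shifted by at most `4 ε r b`, so its Kullback-Leibler
divergence, bounded by chi-square, is at most `κ = 96 ε² r b / β b`.

An auditor that succeeds on both announces the right verdict with probability at least `1 - δ` on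
one instance and the same verdict with probability at most `δ` on the other. The records must then
carry divergence at least `Λ(δ)`. As this divergence is at most `κ` times the expected number of
labels requested in group `b`, that number is at least `Λ(δ) / κ`, which is `β b / (r b ε²)` up to
constants.

On `F` both alternatives `U b` apply and force requests in disjoint groups, so the two bounds add
up. On `U b` only the comparison with `F` is available, which charges group `b`; if `r false = r
true`, both groups have the same `κ`, and half of the bound pays for each.

The divergence argument is run at a fixed horizon `t`, where all functions of the records are
bounded (`le_integral_queried`), for an auditor that requests nothing once it has halted
(`stopped`); then `t → ∞` (`confidenceFactor_le`). -/

instance : Finite Feedback :=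
  Finite.of_surjective (fun o : Option Bool => o.elim Feedback.star Feedback.label) fun x => by
    cases x with
    | star => exact ⟨none, rfl⟩
    | label y => exact ⟨some y, rfl⟩

instance : DiscreteMeasurableSpace Feedback := ⟨fun _ => trivial⟩

/-! ### The law of the records and its one-step recursion -/

namespace Auditor

variable (π : Auditor Bool Bool) (I : AuditInstance Bool Bool)

instance : IsProbabilityMeasure (π.runLaw I) := by
  unfold runLaw; infer_instance

theorem history_succ (ω : π.Run) (t : ℕ) :
    π.history I ω (t + 1) =
      Fin.snoc (π.history I ω t) (π.observe I ω.1 t (π.history I ω t) (ω.2 t)) := rfl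

theorem measurable_observe (t : ℕ) :
    Measurable fun p : (π.Seed × (Fin t → Observation Bool Bool)) × (Bool × Bool × Bool) =>
      π.observe I p.1.1 t p.1.2 p.2 := by
  unfold observe
  have hf : Measurable fun p : (π.Seed × (Fin t → Observation Bool Bool)) × (Bool × Bool × Bool) =>
      I.classifier (p.2.1, p.2.2.1) := I.measurable_classifier.comp (by fun_prop)
  have hr : Measurable fun p : (π.Seed × (Fin t → Observation Bool Bool)) × (Bool × Bool × Bool) =>
      π.request t (p.1.1, p.1.2, p.2.1, p.2.2.1) := (π.measurable_request t).comp (by fun_prop)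
  refine Measurable.prodMk (by fun_prop) (Measurable.prodMk (by fun_prop) (hf.prodMk ?_))
  refine Measurable.ite ?_ (Measurable.of_discrete.comp (by fun_prop)) measurable_const
  exact (hf (measurableSet_singleton true)).union (hr (measurableSet_singleton true))

theorem measurable_snoc {α β : Type*} [MeasurableSpace α] [MeasurableSpace β] {t : ℕ}
    {f : α → Fin t → β} {g : α → β} (hf : Measurable f) (hg : Measurable g) :
    Measurable fun x => (Fin.snoc (f x) (g x) : Fin (t + 1) → β) := by
  refine measurable_pi_iff.2 fun i => ?_
  induction i using Fin.lastCases with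
  | last => simpa using hg
  | cast i => simpa using (measurable_pi_iff.1 hf i)

theorem measurable_history (t : ℕ) : Measurable fun ω : π.Run => π.history I ω t := by
  induction t with
  | zero => exact measurable_const
  | succ t ih =>
    simp only [history_succ]
    exact measurable_snoc ih ((π.measurable_observe I t).comp
      ((measurable_fst.prodMk ih).prodMk (by fun_prop)))

theorem history_congr (s : π.Seed) {x x' : ℕ → Bool × Bool × Bool} (t : ℕ)
    (h : ∀ i < t, x i = x' i) : π.history I (s, x) t = π.history I (s, x') t := by
  induction t with
  | zero => rfl
  | succ t ih =>
    simp only [history_succ]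
    rw [ih fun i hi => h i (by omega), h t (by omega)]

/-- The joint law of the seed and the records of the first `t` rounds. -/
noncomputable def historyLaw (t : ℕ) : Measure (π.Seed × (Fin t → Observation Bool Bool)) :=
  (π.runLaw I).map fun ω => (ω.1, π.history I ω t)

theorem measurable_seed_history (t : ℕ) :
    Measurable fun ω : π.Run => (ω.1, π.history I ω t) :=
  measurable_fst.prodMk (π.measurable_history I t)

instance (t : ℕ) : IsProbabilityMeasure (π.historyLaw I t) :=
  Measure.isProbabilityMeasure_map (π.measurable_seed_history I t).aemeasurable

/-- For a fixed seed the records of the first `t` rounds are a function of the coordinates below `t`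
only. -/
theorem indepFun_history_next (s : π.Seed) (t : ℕ) :
    IndepFun (fun x : ℕ → Bool × Bool × Bool => π.history I (s, x) t) (fun x => x t)
      (Measure.infinitePi fun _ : ℕ => I.law) := by
  have h := iIndepFun_infinitePi (P := fun _ : ℕ => I.law) (X := fun _ z => z)
    (fun _ => measurable_id)
  have h2 := h.indepFun_finset (Finset.range t) {t} (by simp) (fun i => measurable_pi_apply i)
  -- Padding by an arbitrary default turns the first `t` individuals into a stream; `history_congr`
  -- shows that the padding is never read.
  let ext : (Finset.range t → Bool × Bool × Bool) → ℕ → Bool × Bool × Bool :=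
    fun y i => if hi : i ∈ Finset.range t then y ⟨i, hi⟩ else (false, false, false)
  have hext : Measurable ext := measurable_pi_iff.2 fun i => by
    by_cases hi : i ∈ Finset.range t
    · simp only [ext, dif_pos hi]
      exact measurable_pi_apply _
    · simp only [ext, dif_neg hi]
      exact measurable_const
  have hψ : Measurable fun y : ({t} : Finset ℕ) → Bool × Bool × Bool =>
      y ⟨t, Finset.mem_singleton_self t⟩ := measurable_pi_apply _
  have h3 := h2.comp (φ := fun y => π.history I (s, ext y) t)
    (ψ := fun y => y ⟨t, Finset.mem_singleton_self t⟩)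
    ((π.measurable_history I t).comp (measurable_const.prodMk hext)) hψ
  convert h3 using 1
  swap
  · rfl
  funext x
  refine π.history_congr I s t fun i hi => ?_
  simp [ext, hi]

/-- Disintegrating over the seed reduces this to the independence for each fixed seed. -/
theorem map_history_next (t : ℕ) :
    (π.runLaw I).map (fun ω => ((ω.1, π.history I ω t), ω.2 t)) =
      (π.historyLaw I t).prod I.law := by
  have hm : Measurable fun ω : π.Run => ((ω.1, π.history I ω t), ω.2 t) :=
    (π.measurable_seed_history I t).prodMk (by fun_prop)
  have hs : ∀ s : π.Seed, Measurable fun x => π.history I (s, x) t := fun s =>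
    (π.measurable_history I t).comp measurable_prodMk_left
  ext B hB
  have hB' : Measurable fun p => I.law (Prod.mk p ⁻¹' B) := measurable_measure_prodMk_left hB
  rw [Measure.map_apply hm hB, Measure.prod_apply hB, historyLaw,
    lintegral_map hB' (π.measurable_seed_history I t), runLaw, Measure.prod_apply (hm hB),
    lintegral_prod (fun ω : π.Run => I.law (Prod.mk (ω.1, π.history I ω t) ⁻¹' B))
      (hB'.comp (π.measurable_seed_history I t)).aemeasurable]
  refine lintegral_congr fun s => ?_
  have h := (indepFun_iff_map_prod_eq_prod_map_map (hs s).aemeasurable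
    (measurable_pi_apply t).aemeasurable).1 (π.indepFun_history_next I s t)
  rw [Measure.infinitePi_map_eval] at h
  have hC : MeasurableSet {p : (Fin t → Observation Bool Bool) × (Bool × Bool × Bool) |
      ((s, p.1), p.2) ∈ B} :=
    ((measurable_const.prodMk measurable_fst).prodMk measurable_snd) hB
  have h' := DFunLike.congr_fun h {p | ((s, p.1), p.2) ∈ B}
  rw [Measure.map_apply ((hs s).prodMk (measurable_pi_apply t)) hC, Measure.prod_apply hC,
    lintegral_map (measurable_measure_prodMk_left hC) (hs s)] at h'
  exact h'

/-- Conditioning on the first `t` rounds. -/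
theorem integral_historyLaw_succ (t : ℕ)
    {g : π.Seed × (Fin (t + 1) → Observation Bool Bool) → ℝ} (hg : Measurable g) {C : ℝ}
    (hC : ∀ p, |g p| ≤ C) :
    ∫ p, g p ∂(π.historyLaw I (t + 1)) =
      ∫ p, ∑ z, I.law.real {z} * g (p.1, Fin.snoc p.2 (π.observe I p.1 t p.2 z))
        ∂(π.historyLaw I t) := by
  have hm : Measurable fun ω : π.Run => ((ω.1, π.history I ω t), ω.2 t) :=
    (π.measurable_seed_history I t).prodMk (by fun_prop)
  have hn : Measurable fun p : (π.Seed × (Fin t → Observation Bool Bool)) × (Bool × Bool × Bool) =>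
      (p.1.1, (Fin.snoc p.1.2 (π.observe I p.1.1 t p.1.2 p.2) :
        Fin (t + 1) → Observation Bool Bool)) :=
    (by fun_prop : Measurable _).prodMk
      (measurable_snoc (by fun_prop) (π.measurable_observe I t))
  have hint : Integrable (fun p : (π.Seed × (Fin t → Observation Bool Bool)) ×
      (Bool × Bool × Bool) => g (p.1.1, Fin.snoc p.1.2 (π.observe I p.1.1 t p.1.2 p.2)))
      ((π.historyLaw I t).prod I.law) :=
    Integrable.of_bound (hg.comp hn).aestronglyMeasurable C (.of_forall fun p => hC _)
  have : π.historyLaw I (t + 1) = ((π.historyLaw I t).prod I.law).map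
      fun p => (p.1.1, Fin.snoc p.1.2 (π.observe I p.1.1 t p.1.2 p.2)) := by
    rw [← map_history_next, Measure.map_map hn hm]
    rfl
  rw [this, integral_map hn.aemeasurable hg.aestronglyMeasurable, integral_prod _ hint]
  refine integral_congr_ae (.of_forall fun p => ?_)
  exact integral_fintype Integrable.of_finite

end Auditor

/-! ### Silencing requests after the auditor has halted -/

namespace Auditor

variable (π : Auditor Bool Bool) (I J : AuditInstance Bool Bool)

/-- The auditor that behaves like `π` but requests no label after the time at which `π` stops. -/
noncomputable def stopped : Auditor Bool Bool where
  Seed := π.Seed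
  seedLaw := π.seedLaw
  isProb := π.isProb
  halt := π.halt
  verdict := π.verdict
  -- The range includes `i = t`: an auditor that halts after `t` rounds never plays the round with
  -- index `t`.
  request t p := π.request t p && !decide (∃ i : Fin (t + 1),
    π.halt i (p.1, fun j : Fin i => p.2.1 (Fin.castLE (Nat.lt_succ_iff.1 i.2) j)) = true)
  measurable_halt := π.measurable_halt
  measurable_verdict := π.measurable_verdict
  measurable_request t := by
    have h : MeasurableSet {p : π.Seed × (Fin t → Observation Bool Bool) × Bool × Bool |
        ∃ i : Fin (t + 1), π.halt i
          (p.1, fun j : Fin i => p.2.1 (Fin.castLE (Nat.lt_succ_iff.1 i.2) j)) = true} := by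
      simp only [Set.ofPred_exists]
      refine MeasurableSet.iUnion fun i => ?_
      exact ((π.measurable_halt i).comp (by fun_prop)) (measurableSet_singleton true)
    refine measurable_to_bool ?_
    have h2 := ((π.measurable_request t) (measurableSet_singleton true)).diff h
    convert h2 using 1
    ext p
    simp

/-- The records of `π.stopped`. -/
noncomputable def stoppedHistory (ω : π.Run) (t : ℕ) : Fin t → Observation Bool Bool :=
  π.stopped.history I ω t

theorem history_castLE (ω : π.Run) {i t : ℕ} (h : i ≤ t) :
    (fun j : Fin i => π.history I ω t (Fin.castLE h j)) = π.history I ω i := by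
  induction t, h using Nat.le_induction with
  | base => rfl
  | succ t h ih =>
    rw [← ih]
    funext j
    rw [history_succ]
    exact Fin.snoc_castSucc (α := fun _ => Observation Bool Bool) _ _ (Fin.castLE h j)

theorem history_apply (ω : π.Run) {t : ℕ} (i : Fin t) :
    π.history I ω t i = π.observe I ω.1 i (π.history I ω i) (ω.2 i) := by
  have h := congrFun (π.history_castLE I ω (i := i + 1) i.2) (Fin.last i)
  rw [history_succ, Fin.snoc_last] at h
  exact h

theorem stoppedHistory_castLE (ω : π.Run) {i t : ℕ} (h : i ≤ t) :
    (fun j : Fin i => π.stoppedHistory I ω t (Fin.castLE h j)) = π.stoppedHistory I ω i :=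
  π.stopped.history_castLE I ω h

/-- The auditor still requests the label of an individual with features and group `z`. -/
def activeRequest (s : π.Seed) (x : ℕ → Bool × Bool × Bool) (t : ℕ) (z : Bool × Bool) : Prop :=
  π.request t (s, π.stoppedHistory I (s, x) t, z) = true ∧
    ∀ i ≤ t, π.halt i (s, π.stoppedHistory I (s, x) i) = false

theorem stopped_request_iff (s : π.Seed) (x : ℕ → Bool × Bool × Bool) (t : ℕ) (z : Bool × Bool) :
    π.stopped.request t (s, π.stoppedHistory I (s, x) t, z) = true ↔
      π.activeRequest I s x t z := by
  have e : π.stopped.request t (s, π.stoppedHistory I (s, x) t, z) =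
    (π.request t (s, π.stoppedHistory I (s, x) t, z) && !decide (∃ i : Fin (t + 1),
      π.halt i (s, fun j : Fin i =>
        π.stoppedHistory I (s, x) t (Fin.castLE (Nat.lt_succ_iff.1 i.2) j)) = true)) := rfl
  rw [e, activeRequest]
  simp only [Bool.and_eq_true, Bool.not_eq_true', decide_eq_false_iff_not, not_exists,
    Bool.not_eq_true]
  refine and_congr_right fun _ => ⟨fun h i hi => ?_, fun h i => ?_⟩
  · have := h ⟨i, by omega⟩
    rwa [π.stoppedHistory_castLE I (s, x) hi] at this
  · have := h i (by omega)
    rwa [← π.stoppedHistory_castLE I (s, x) (Nat.lt_succ_iff.1 i.2)] at this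

open Classical in
theorem stoppedHistory_succ (s : π.Seed) (x : ℕ → Bool × Bool × Bool) (t : ℕ) :
    π.stoppedHistory I (s, x) (t + 1) = Fin.snoc (π.stoppedHistory I (s, x) t)
      ((x t).1, (x t).2.1, I.classifier ((x t).1, (x t).2.1),
        if I.classifier ((x t).1, (x t).2.1) = true ∨ π.activeRequest I s x t ((x t).1, (x t).2.1)
        then Feedback.label (x t).2.2 else Feedback.star) := by
  have h := π.stopped.history_succ I (s, x) t
  refine h.trans ?_
  simp only [observe, ← stopped_request_iff]
  rfl

theorem stoppedHistory_eq_of_not_halt (s : π.Seed) (x : ℕ → Bool × Bool × Bool) (t : ℕ)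
    (h : ∀ i < t, π.halt i (s, π.history I (s, x) i) = false) :
    π.stoppedHistory I (s, x) t = π.history I (s, x) t := by
  induction t using Nat.strong_induction_on with
  | _ t ih =>
  cases t with
  | zero => rfl
  | succ t =>
    have hi : ∀ i ≤ t, π.stoppedHistory I (s, x) i = π.history I (s, x) i := fun i hi =>
      ih i (by omega) fun j hj => h j (by omega)
    have hr : ∀ z, π.activeRequest I s x t z ↔ π.request t (s, π.history I (s, x) t, z) = true := by
      intro z
      rw [activeRequest, hi t le_rfl]
      exact and_iff_left fun i hit => by rw [hi i hit]; exact h i (by omega)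
    rw [stoppedHistory_succ, history_succ, hi t le_rfl]
    simp only [hr, observe]

/-- Here not halting is read off the silenced records themselves; by induction these agree with the
true ones so far, which turns the hypothesis into that of the previous lemma. -/
theorem stoppedHistory_eq_of_not_halt' (s : π.Seed) (x : ℕ → Bool × Bool × Bool) (t : ℕ)
    (h : ∀ i < t, π.halt i (s, π.stoppedHistory I (s, x) i) = false) :
    ∀ i ≤ t, π.stoppedHistory I (s, x) i = π.history I (s, x) i := by
  induction t with
  | zero =>
    intro i hi
    obtain rfl : i = 0 := by omega
    rfl
  | succ t ih =>
    have ih' := ih fun i hi => h i (by omega)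
    have : ∀ i < t + 1, π.halt i (s, π.history I (s, x) i) = false := fun i hi => by
      rw [← ih' i (by omega)]; exact h i hi
    exact fun i hi => π.stoppedHistory_eq_of_not_halt I s x i fun j hj => this j (by omega)

/-- After `t` rounds the auditor stops and announces `v`. -/
def announcesAt (v : Verdict) (t : ℕ) (s : π.Seed) (h : (i : ℕ) → Fin i → Observation Bool Bool) :
    Prop :=
  π.halt t (s, h t) = true ∧ (∀ i < t, π.halt i (s, h i) = false) ∧ π.verdict t (s, h t) = v

theorem runningTime_eq_iff (ω : π.Run) (t : ℕ) :
    π.runningTime I ω = t ↔ π.halt t (ω.1, π.history I ω t) = true ∧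
      ∀ i < t, π.halt i (ω.1, π.history I ω i) = false := by
  unfold runningTime
  constructor
  · intro h
    have hne : Nonempty {t : ℕ // π.haltsAt I ω t} := by
      by_contra hne
      rw [not_nonempty_iff] at hne
      rw [iInf_of_empty] at h
      exact ENat.natCast_ne_top t h.symm
    obtain ⟨⟨t', ht'⟩, he⟩ := ENat.exists_eq_iInf (fun t : {t : ℕ // π.haltsAt I ω t} => ((t : ℕ) : ℕ∞))
    rw [h] at he
    obtain rfl : t' = t := by exact_mod_cast he
    refine ⟨ht', fun i hi => ?_⟩
    by_contra hc
    have := iInf_le (fun t : {t : ℕ // π.haltsAt I ω t} => ((t : ℕ) : ℕ∞))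
      ⟨i, by simpa [haltsAt] using hc⟩
    rw [h] at this
    have : t' ≤ i := by exact_mod_cast this
    omega
  · rintro ⟨h1, h2⟩
    refine le_antisymm (iInf_le (fun t : {t : ℕ // π.haltsAt I ω t} => ((t : ℕ) : ℕ∞)) ⟨t, h1⟩)
      (le_iInf fun i => ?_)
    by_contra hc
    have hc : (i : ℕ) < t := by exact_mod_cast not_le.1 hc
    have := i.2
    simp [haltsAt, h2 i hc] at this

theorem lt_runningTime (ω : π.Run) (t : ℕ)
    (h : ∀ i ≤ t, π.halt i (ω.1, π.history I ω i) = false) : (t : ℕ∞) < π.runningTime I ω := by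
  have : ((t + 1 : ℕ) : ℕ∞) ≤ π.runningTime I ω := le_iInf fun i => by
    have hi := i.2
    by_contra hc
    have hc : (i : ℕ) < t + 1 := by exact_mod_cast not_le.1 hc
    simp [haltsAt, h i (by omega)] at hi
  exact lt_of_lt_of_le (by exact_mod_cast Nat.lt_succ_self t) this

/-- Silencing changes nothing up to the halting time, and the verdict depends only on the records up
to then. -/
theorem announces_iff (v : Verdict) (ω : π.Run) :
    π.announces I v ω ↔ ∃ t, π.announcesAt v t ω.1 (π.stoppedHistory I ω) := by
  unfold announces announcesAt
  refine exists_congr fun t => ?_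
  rw [runningTime_eq_iff, and_assoc]
  obtain ⟨s, x⟩ := ω
  constructor
  · rintro ⟨h1, h2, h3⟩
    have := fun i (hi : i ≤ t) => π.stoppedHistory_eq_of_not_halt I s x i fun j hj => h2 j (by omega)
    refine ⟨by rw [this t le_rfl]; exact h1, fun i hi => by rw [this i hi.le]; exact h2 i hi,
      by rw [this t le_rfl]; exact h3⟩
  · rintro ⟨h1, h2, h3⟩
    have := π.stoppedHistory_eq_of_not_halt' I s x t h2
    rw [this t le_rfl] at h1 h3
    exact ⟨h1, fun i hi => by have := this i hi.le; rw [← this]; exact h2 i hi, h3⟩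

theorem requestsLabel_of_stopped (ω : π.Run) (t : ℕ)
    (hc : I.classifier ((ω.2 t).1, (ω.2 t).2.1) = false)
    (hr : π.activeRequest I ω.1 ω.2 t ((ω.2 t).1, (ω.2 t).2.1)) :
    π.requestsLabel I ω t := by
  obtain ⟨s, x⟩ := ω
  obtain ⟨h1, h2⟩ := hr
  have h := π.stoppedHistory_eq_of_not_halt' I s x t fun i hi => h2 i hi.le
  refine ⟨π.lt_runningTime I (s, x) t fun i hi => ?_, hc, ?_⟩
  · have := h i hi
    have h3 := h2 i hi
    rwa [this] at h3
  · rwa [h t le_rfl] at h1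

/-- The event that `v` is announced within the first `t` rounds. -/
def announcedBy (v : Verdict) (t : ℕ) : Set (π.Seed × (Fin t → Observation Bool Bool)) :=
  {p | ∃ k : Fin (t + 1), π.halt k (p.1, fun j => p.2 (Fin.castLE (Nat.lt_succ_iff.1 k.2) j)) = true ∧
    (∀ i : Fin k, π.halt i (p.1, fun j => p.2 (Fin.castLE
      (i.2.le.trans (Nat.lt_succ_iff.1 k.2)) j)) = false) ∧
    π.verdict k (p.1, fun j => p.2 (Fin.castLE (Nat.lt_succ_iff.1 k.2) j)) = v}

theorem measurableSet_announcedBy (v : Verdict) (t : ℕ) : MeasurableSet (π.announcedBy v t) := by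
  simp only [announcedBy, Set.ofPred_exists, Set.ofPred_and, Set.ofPred_forall]
  refine MeasurableSet.iUnion fun k => MeasurableSet.inter ?_ (MeasurableSet.inter
    (MeasurableSet.iInter fun i => ?_) ?_)
  · exact ((π.measurable_halt k).comp (by fun_prop)) (measurableSet_singleton true)
  · exact ((π.measurable_halt i).comp (by fun_prop)) (measurableSet_singleton false)
  · exact ((π.measurable_verdict k).comp (by fun_prop)) (measurableSet_singleton v)

theorem mem_announcedBy_iff (v : Verdict) (t : ℕ) (ω : π.Run) :
    (ω.1, π.stoppedHistory I ω t) ∈ π.announcedBy v t ↔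
      ∃ k ≤ t, π.announcesAt v k ω.1 (π.stoppedHistory I ω) := by
  have e := fun {i : ℕ} (h : i ≤ t) => π.stoppedHistory_castLE I ω h
  constructor
  · rintro ⟨k, h1, h2, h3⟩
    refine ⟨k, Nat.lt_succ_iff.1 k.2, ?_, fun i hi => ?_, ?_⟩
    · rwa [← e]
    · rw [← e]; exact h2 ⟨i, hi⟩
    · rwa [← e]
  · rintro ⟨k, hk, h1, h2, h3⟩
    refine ⟨⟨k, Nat.lt_succ_iff.2 hk⟩, ?_, fun i => ?_, ?_⟩
    · rwa [← e hk] at h1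
    · have := h2 i i.2
      rwa [← e (i.2.le.trans hk)] at this
    · rwa [← e hk] at h3

end Auditor
-- Likelihood ratios and the change of measure
/-- The likelihood ratio of the label revealed in an observation, between the instances `J`
and `I`. -/
noncomputable def likelihoodRatio (I J : AuditInstance Bool Bool) (o : Observation Bool Bool) : ℝ :=
  match o.2.2.2 with
  | Feedback.star => 1
  | Feedback.label y => J.law.real {(o.1, o.2.1, y)} / I.law.real {(o.1, o.2.1, y)}

open Classical in
/-- Indicator of the observation of a requested label in the group `b`. -/
noncomputable def queried (b : Bool) (o : Observation Bool Bool) : ℝ :=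
  if o.2.1 = b ∧ o.2.2.1 = false ∧ o.2.2.2 ≠ Feedback.star then 1 else 0

/-- Record sequences of a fixed length form a finite type, so this settles integrability of
likelihood ratios, their logarithms and counts. -/
theorem exists_bound {α : Type*} [Finite α] (f : α → ℝ) : ∃ C, ∀ x, |f x| ≤ C := by
  obtain ⟨C, hC⟩ := (Set.finite_range fun x => |f x|).bddAbove
  exact ⟨C, fun x => hC ⟨x, rfl⟩⟩

theorem sum_law (I : AuditInstance Bool Bool) : ∑ z, I.law.real {z} = 1 := by
  simp

/-- Two instances with the same classifier, whose laws have full support and the same marginal on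
features and groups. -/
structure Comparable (I J : AuditInstance Bool Bool) : Prop where
  classifier_eq : J.classifier = I.classifier
  pos_left : ∀ z, 0 < I.law.real {z}
  pos_right : ∀ z, 0 < J.law.real {z}
  marginal_eq : ∀ x a, ∑ y, J.law.real {(x, a, y)} = ∑ y, I.law.real {(x, a, y)}

theorem Comparable.symm {I J : AuditInstance Bool Bool} (h : Comparable I J) : Comparable J I :=
  ⟨h.classifier_eq.symm, h.pos_right, h.pos_left, fun x a => (h.marginal_eq x a).symm⟩

theorem Comparable.likelihoodRatio_pos {I J : AuditInstance Bool Bool} (h : Comparable I J)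
    (o : Observation Bool Bool) : 0 < likelihoodRatio I J o := by
  unfold likelihoodRatio
  split
  · exact one_pos
  · exact div_pos (h.pos_right _) (h.pos_left _)

namespace Auditor

variable (π : Auditor Bool Bool) {I J : AuditInstance Bool Bool}

/-- A revealed label is reweighted point by point; a hidden one has ratio `1`, and then only the
common marginal on features and groups matters. -/
theorem sum_observe_eq (hIJ : Comparable I J) (φ : Observation Bool Bool → ℝ) (s : π.Seed) (t : ℕ)
    (h : Fin t → Observation Bool Bool) :
    ∑ z, J.law.real {z} * φ (π.observe J s t h z) =
      ∑ z, I.law.real {z} * (φ (π.observe I s t h z) *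
        likelihoodRatio I J (π.observe I s t h z)) := by
  rw [Fintype.sum_prod_type, Fintype.sum_prod_type]
  refine Finset.sum_congr rfl fun x _ => ?_
  rw [Fintype.sum_prod_type, Fintype.sum_prod_type]
  refine Finset.sum_congr rfl fun a _ => ?_
  simp only [observe, hIJ.classifier_eq]
  by_cases hr : I.classifier (x, a) = true ∨ π.request t (s, h, x, a) = true
  · simp only [hr, if_true, likelihoodRatio]
    refine Finset.sum_congr rfl fun y _ => ?_
    have := (hIJ.pos_left (x, a, y)).ne'
    field_simp
  · simp only [hr, if_false, likelihoodRatio, mul_one]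
    rw [← Finset.sum_mul, ← Finset.sum_mul, hIJ.marginal_eq]

/-- The divergence of one round is at most `κ` times the expected number of requests in it. -/
theorem sum_observe_nonneg {b : Bool} {κ : ℝ}
    (hκ : ∀ x a, 0 ≤ ∑ y, I.law.real {(x, a, y)} * (κ * (if a = b ∧ I.classifier (x, a) = false
      then 1 else 0) + Real.log (J.law.real {(x, a, y)} / I.law.real {(x, a, y)})))
    (s : π.Seed) (t : ℕ) (h : Fin t → Observation Bool Bool) :
    0 ≤ ∑ z, I.law.real {z} * (κ * queried b (π.observe I s t h z) +
        Real.log (likelihoodRatio I J (π.observe I s t h z))) := by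
  rw [Fintype.sum_prod_type]
  refine Finset.sum_nonneg fun x _ => ?_
  rw [Fintype.sum_prod_type]
  refine Finset.sum_nonneg fun a _ => ?_
  simp only [observe]
  by_cases hr : I.classifier (x, a) = true ∨ π.request t (s, h, x, a) = true
  · simpa [hr, likelihoodRatio, queried] using hκ x a
  · simp [hr, likelihoodRatio, queried]

theorem historyLaw_zero : π.historyLaw I 0 = π.seedLaw.map fun s => (s, Fin.elim0) := by
  have h : (fun ω : π.Run => (ω.1, π.history I ω 0)) =
    (fun s : π.Seed => (s, (Fin.elim0 : Fin 0 → Observation Bool Bool))) ∘ Prod.fst := rfl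
  rw [historyLaw, h, ← Measure.map_map (by fun_prop) measurable_fst, runLaw, Measure.map_fst_prod]
  simp

theorem integrable_historyLaw {t : ℕ} {g : π.Seed × (Fin t → Observation Bool Bool) → ℝ}
    (hg : Measurable g) {C : ℝ} (hC : ∀ p, |g p| ≤ C) : Integrable g (π.historyLaw I t) :=
  Integrable.of_bound hg.aestronglyMeasurable C (.of_forall hC)

theorem measurable_sum_observe (t : ℕ)
    {g : π.Seed × (Fin (t + 1) → Observation Bool Bool) → ℝ} (hg : Measurable g) :
    Measurable fun p : π.Seed × (Fin t → Observation Bool Bool) =>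
      ∑ z, J.law.real {z} * g (p.1, Fin.snoc p.2 (π.observe I p.1 t p.2 z)) := by
  refine Finset.measurable_sum _ fun z _ => Measurable.const_mul (hg.comp ?_) _
  exact measurable_fst.prodMk (measurable_snoc measurable_snd
    ((π.measurable_observe I t).comp (measurable_id.prodMk measurable_const)))

/-- Change of measure for the records of the first `t` rounds. -/
theorem integral_historyLaw_eq (hIJ : Comparable I J) (t : ℕ)
    {g : π.Seed × (Fin t → Observation Bool Bool) → ℝ} (hg : Measurable g) {C : ℝ}
    (hC : ∀ p, |g p| ≤ C) :
    ∫ p, g p ∂(π.historyLaw J t) =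
      ∫ p, g p * ∏ i, likelihoodRatio I J (p.2 i) ∂(π.historyLaw I t) := by
  induction t generalizing C with
  | zero => simp [historyLaw_zero]
  | succ t ih =>
    obtain ⟨D, hD⟩ := exists_bound fun h : Fin (t + 1) → Observation Bool Bool =>
      ∏ i, likelihoodRatio I J (h i)
    have hmeas : Measurable fun p : π.Seed × (Fin (t + 1) → Observation Bool Bool) =>
        ∏ i, likelihoodRatio I J (p.2 i) :=
      (Measurable.of_discrete (f := fun h : Fin (t + 1) → Observation Bool Bool =>
        ∏ i, likelihoodRatio I J (h i))).comp measurable_snd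
    rw [π.integral_historyLaw_succ J t hg hC,
      π.integral_historyLaw_succ I t 
        (g := fun p => g p * ∏ i, likelihoodRatio I J (p.2 i)) (hg.mul hmeas) (C := C * D) fun p => by
        rw [abs_mul]
        exact mul_le_mul (hC p) (hD p.2) (abs_nonneg _) ((abs_nonneg _).trans (hC p))]
    -- The induction hypothesis is applied to `g` with the last round integrated out under `J`.
    rw [ih (π.measurable_sum_observe t hg) (C := ∑ z, J.law.real {z} * C) fun p => by
      refine (Finset.abs_sum_le_sum_abs _ _).trans (Finset.sum_le_sum fun z _ => ?_)
      rw [abs_mul, abs_of_nonneg measureReal_nonneg]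
      exact mul_le_mul_of_nonneg_left (hC _) measureReal_nonneg]
    refine integral_congr_ae (.of_forall fun p => ?_)
    simp only
    rw [π.sum_observe_eq hIJ fun o => g (p.1, Fin.snoc p.2 o), Finset.sum_mul]
    refine Finset.sum_congr rfl fun z _ => ?_
    simp only [Fin.prod_univ_castSucc, Fin.snoc_castSucc, Fin.snoc_last]
    ring

/-- The increments have nonnegative conditional expectation given the past (`sum_observe_nonneg`),
so the sums form a submartingale started at `0`. Hence the divergence of the records is at most `κ`
times the expected number of requests in group `b`. -/
theorem integral_log_nonneg {b : Bool} {κ : ℝ}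
    (hκ : ∀ x a, 0 ≤ ∑ y, I.law.real {(x, a, y)} * (κ * (if a = b ∧ I.classifier (x, a) = false
      then 1 else 0) + Real.log (J.law.real {(x, a, y)} / I.law.real {(x, a, y)}))) (t : ℕ) :
    0 ≤ ∫ p, ∑ i, (κ * queried b (p.2 i) + Real.log (likelihoodRatio I J (p.2 i)))
      ∂(π.historyLaw I t) := by
  have hm : ∀ t, Measurable fun p : π.Seed × (Fin t → Observation Bool Bool) =>
      ∑ i, (κ * queried b (p.2 i) + Real.log (likelihoodRatio I J (p.2 i))) := fun t =>
    (Measurable.of_discrete (f := fun h : Fin t → Observation Bool Bool =>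
      ∑ i, (κ * queried b (h i) + Real.log (likelihoodRatio I J (h i))))).comp measurable_snd
  have hb : ∀ t, ∃ C, ∀ h : Fin t → Observation Bool Bool,
      |∑ i, (κ * queried b (h i) + Real.log (likelihoodRatio I J (h i)))| ≤ C := fun t =>
    exists_bound _
  induction t with
  | zero => simp
  | succ t ih =>
    obtain ⟨C, hC⟩ := hb t
    obtain ⟨D, hD⟩ := hb (t + 1)
    rw [π.integral_historyLaw_succ I t (hm (t + 1)) fun p => hD p.2]
    refine ih.trans (integral_mono (π.integrable_historyLaw (hm t) fun p => hC p.2)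
      (π.integrable_historyLaw (π.measurable_sum_observe t (hm (t + 1))) (C := ∑ z, I.law.real {z} * D)
        fun p => ?_) fun p => ?_)
    · refine (Finset.abs_sum_le_sum_abs _ _).trans (Finset.sum_le_sum fun z _ => ?_)
      rw [abs_mul, abs_of_nonneg measureReal_nonneg]
      exact mul_le_mul_of_nonneg_left (hD _) measureReal_nonneg
    · simp only [Fin.sum_univ_castSucc, Fin.snoc_castSucc, Fin.snoc_last]
      have := π.sum_observe_nonneg hκ p.1 t p.2
      simp only [mul_add, Finset.sum_add_distrib, ← Finset.sum_mul, sum_law, one_mul] at this ⊢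
      linarith

/-- The logarithm lies below its tangent at `α`. -/
theorem log_le_of_pos {α Z : ℝ} (hα : 0 < α) (hZ : 0 < Z) :
    Real.log Z ≤ Real.log α + α⁻¹ * Z - 1 := by
  have := Real.log_le_sub_one_of_pos (mul_pos (inv_pos.2 hα) hZ)
  rw [Real.log_mul (inv_pos.2 hα).ne' hZ.ne', Real.log_inv] at this
  linarith

/-- Data processing for the event `B`, in a form linear in its probability under `I`: the
log-likelihood ratio is bounded by the tangent at `α = δ / (1 - δ)` on `B` and at `α⁻¹` off `B`.
These are the likelihood ratios of `B` and its complement in the extremal case of probabilities `1 -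
δ` and `δ`. -/
theorem le_integral_queried (hIJ : Comparable I J) {b : Bool} {κ : ℝ}
    (hκ : ∀ x a, 0 ≤ ∑ y, I.law.real {(x, a, y)} * (κ * (if a = b ∧ I.classifier (x, a) = false
      then 1 else 0) + Real.log (J.law.real {(x, a, y)} / I.law.real {(x, a, y)}))) (t : ℕ)
    {B : Set (π.Seed × (Fin t → Observation Bool Bool))} (hB : MeasurableSet B) {δ : ℝ}
    (hδ : 0 < δ) (hδ' : δ < 1 / 2) (hJB : (π.historyLaw J t).real B ≤ δ) :
    (2 * (π.historyLaw I t).real B - 1) * Real.log ((1 - δ) / δ) ≤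
      κ * ∫ p, ∑ i, queried b (p.2 i) ∂(π.historyLaw I t) := by
  classical
  set α : ℝ := δ / (1 - δ) with hα
  have hα0 : 0 < α := div_pos hδ (by linarith)
  have hα1 : α ≤ 1 := by rw [hα, div_le_one (by linarith)]; linarith
  have hlog : Real.log ((1 - δ) / δ) = -Real.log α := by
    rw [hα, ← Real.log_inv, inv_div]
  let L : π.Seed × (Fin t → Observation Bool Bool) → ℝ := fun p =>
    ∑ i, Real.log (likelihoodRatio I J (p.2 i))
  let K : π.Seed × (Fin t → Observation Bool Bool) → ℝ := fun p => ∑ i, queried b (p.2 i)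
  let Z : π.Seed × (Fin t → Observation Bool Bool) → ℝ := fun p =>
    ∏ i, likelihoodRatio I J (p.2 i)
  -- The slope of the tangent: `α⁻¹` on `B` and `α` off `B`.
  let g : π.Seed × (Fin t → Observation Bool Bool) → ℝ := fun p =>
    α + (α⁻¹ - α) * B.indicator (fun _ => (1 : ℝ)) p
  have hfin : ∀ f : (Fin t → Observation Bool Bool) → ℝ,
      Integrable (fun p => f p.2) (π.historyLaw I t) := fun f => by
    obtain ⟨C, hC⟩ := exists_bound f
    exact π.integrable_historyLaw (Measurable.of_discrete.comp measurable_snd) fun p => hC p.2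
  have hLi : Integrable L (π.historyLaw I t) := hfin fun h => ∑ i, Real.log (likelihoodRatio I J (h i))
  have hKi : Integrable K (π.historyLaw I t) := hfin fun h => ∑ i, queried b (h i)
  have hZi : Integrable Z (π.historyLaw I t) := hfin fun h => ∏ i, likelihoodRatio I J (h i)
  have hind : ∀ I' : AuditInstance Bool Bool,
      Integrable (B.indicator (fun _ => (1 : ℝ))) (π.historyLaw I' t) := fun I' =>
    (integrable_const 1).indicator hB
  have hint : ∀ I' : AuditInstance Bool Bool,
      ∫ p, B.indicator (fun _ => (1 : ℝ)) p ∂(π.historyLaw I' t) = (π.historyLaw I' t).real B := fun I' =>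
    integral_indicator_one hB
  have hgm : Measurable g := by
    have : Measurable (B.indicator (fun _ => (1 : ℝ))) := measurable_const.indicator hB
    fun_prop
  have hgb : ∀ p, |g p| ≤ |α| + |α⁻¹ - α| := fun p => by
    refine (abs_add_le _ _).trans (add_le_add_right ?_ _)
    rw [abs_mul]
    refine mul_le_of_le_one_right (abs_nonneg _) ?_
    by_cases hp : p ∈ B <;> simp [hp]
  have hgZ : Integrable (fun p => g p * Z p) (π.historyLaw I t) :=
    hZi.bdd_mul hgm.aestronglyMeasurable (.of_forall hgb)
  have hchange : ∫ p, g p * Z p ∂(π.historyLaw I t) =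
      α + (α⁻¹ - α) * (π.historyLaw J t).real B := by
    rw [← π.integral_historyLaw_eq hIJ t hgm hgb]
    simp only [g]
    rw [integral_add (integrable_const _) ((hind J).const_mul _), integral_const_mul, hint]
    simp
  have hpt : ∀ p, L p ≤ (g p * Z p + 2 * Real.log α * B.indicator (fun _ => (1 : ℝ)) p) - (Real.log α + 1) := by
    intro p
    have hpos : 0 < Z p := Finset.prod_pos fun i _ => hIJ.likelihoodRatio_pos _
    have hL : L p = Real.log (Z p) :=
      (Real.log_prod fun i _ => (hIJ.likelihoodRatio_pos _).ne').symm
    by_cases hp : p ∈ B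
    · have := log_le_of_pos hα0 hpos
      simp [g, hp]
      linarith
    · have := log_le_of_pos (inv_pos.2 hα0) hpos
      rw [Real.log_inv, inv_inv] at this
      simp [g, hp]
      linarith
  have hmono := integral_mono hLi ((hgZ.add ((hind I).const_mul (2 * Real.log α))).sub
    (integrable_const (Real.log α + 1))) hpt
  rw [integral_sub' (hgZ.add ((hind I).const_mul (2 * Real.log α))) (integrable_const _),
    integral_add' hgZ ((hind I).const_mul (2 * Real.log α)), hchange, integral_const_mul, hint] at hmono
  simp only [integral_const, probReal_univ, one_smul] at hmono
  have hnn := π.integral_log_nonneg (J := J) hκ t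
  have hsplit : ∫ p, ∑ i, (κ * queried b (p.2 i) + Real.log (likelihoodRatio I J (p.2 i)))
      ∂(π.historyLaw I t) = κ * ∫ p, K p ∂(π.historyLaw I t) + ∫ p, L p ∂(π.historyLaw I t) := by
    rw [← integral_const_mul, ← integral_add (hKi.const_mul κ) hLi]
    simp only [K, L, Finset.sum_add_distrib, Finset.mul_sum]
  rw [hsplit] at hnn
  -- The left side increases with the probability of `B` under `J` and equals `1` when that is `δ`;
  -- this cancels the `-1` of the tangents.
  have hq : α + (α⁻¹ - α) * (π.historyLaw J t).real B ≤ 1 := by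
    have h1 : 0 ≤ α⁻¹ - α := sub_nonneg.2 (hα1.trans (one_le_inv₀ hα0 |>.2 hα1))
    have h2 : α + (α⁻¹ - α) * δ = 1 := by
      rw [hα]
      have : (1 - δ) ≠ 0 := by linarith
      field_simp
      ring
    nlinarith [mul_le_mul_of_nonneg_left hJB h1]
  rw [hlog]
  change _ ≤ κ * ∫ p, K p ∂(π.historyLaw I t)
  nlinarith

/-! ### Counting requests and passing to an infinite horizon -/

open Classical in
/-- The number of true labels requested in the group `b`. -/
noncomputable def groupLabelCount (I : AuditInstance Bool Bool) (b : Bool) (ω : π.Run) : ℝ≥0∞ :=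
  ∑' t : ℕ, if π.requestsLabel I ω t ∧ (ω.2 t).2.1 = b then 1 else 0

theorem groupLabelCount_add (ω : π.Run) :
    π.groupLabelCount I false ω + π.groupLabelCount I true ω = π.labelCount I ω := by
  unfold groupLabelCount labelCount
  rw [← ENNReal.tsum_add]
  refine tsum_congr fun t => ?_
  by_cases h : π.requestsLabel I ω t <;> cases hb : (ω.2 t).2.1 <;> simp [h]

theorem groupLabelCount_le (b : Bool) (ω : π.Run) :
    π.groupLabelCount I b ω ≤ π.labelCount I ω := by
  rw [← groupLabelCount_add]
  cases b
  · exact le_self_add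
  · exact le_add_self

theorem stoppedHistory_apply (ω : π.Run) {t : ℕ} (i : Fin t) :
    π.stoppedHistory I ω t i =
      π.stopped.observe I ω.1 i (π.stoppedHistory I ω i) (ω.2 i) :=
  π.stopped.history_apply I ω i

-- The record of a negatively classified individual shows a label only after a request by the
-- silenced auditor, that is, one that `π` makes while still active.
open Classical in
theorem queried_stoppedHistory_le (b : Bool) (ω : π.Run) {t : ℕ} (i : Fin t) :
    ENNReal.ofReal (queried b (π.stoppedHistory I ω t i)) ≤
      if π.requestsLabel I ω i ∧ (ω.2 i).2.1 = b then 1 else 0 := by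
  rw [stoppedHistory_apply]
  unfold queried
  split_ifs with h1 h2
  · simp
  · obtain ⟨hb, hc, hf⟩ := h1
    refine absurd ⟨π.requestsLabel_of_stopped I ω i hc ?_, hb⟩ h2
    rw [← stopped_request_iff]
    by_contra hr
    change I.classifier ((ω.2 i).1, (ω.2 i).2.1) = false at hc
    have hn : ¬ (I.classifier ((ω.2 i).1, (ω.2 i).2.1) = true ∨
        π.stopped.request i (ω.1, π.stoppedHistory I ω i, (ω.2 i).1, (ω.2 i).2.1) = true) := by
      rw [hc]
      simpa using hr
    exact hf (if_neg hn)
  · simp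
  · simp

theorem sum_queried_le (b : Bool) (ω : π.Run) (t : ℕ) :
    ENNReal.ofReal (∑ i, queried b (π.stoppedHistory I ω t i)) ≤ π.groupLabelCount I b ω := by
  classical
  rw [ENNReal.ofReal_sum_of_nonneg fun i _ => by unfold queried; split_ifs <;> norm_num]
  refine (Finset.sum_le_sum fun i _ => π.queried_stoppedHistory_le b ω i).trans ?_
  rw [Fin.sum_univ_eq_sum_range
    (fun i => if π.requestsLabel I ω i ∧ (ω.2 i).2.1 = b then (1 : ℝ≥0∞) else 0)]
  exact ENNReal.sum_le_tsum _

theorem ofReal_integral_queried_le (b : Bool) (t : ℕ) :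
    ENNReal.ofReal (∫ p, ∑ i, queried b (p.2 i) ∂(π.stopped.historyLaw I t)) ≤
      ∫⁻ ω, π.groupLabelCount I b ω ∂(π.runLaw I) := by
  have hm : Measurable fun p : π.stopped.Seed × (Fin t → Observation Bool Bool) =>
      ∑ i, queried b (p.2 i) :=
    (Measurable.of_discrete (f := fun h : Fin t → Observation Bool Bool =>
      ∑ i, queried b (h i))).comp measurable_snd
  obtain ⟨C, hC⟩ := exists_bound fun h : Fin t → Observation Bool Bool => ∑ i, queried b (h i)
  rw [ofReal_integral_eq_lintegral_ofReal
    (π.stopped.integrable_historyLaw hm fun p => hC p.2) (.of_forall fun p =>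
      Finset.sum_nonneg fun i _ => by unfold queried; split_ifs <;> norm_num),
    historyLaw, lintegral_map hm.ennreal_ofReal (π.stopped.measurable_seed_history I t)]
  exact lintegral_mono fun ω => π.sum_queried_le b ω t

/-- The runs in which `v` is announced within the first `t` rounds. -/
def announcedRuns (I : AuditInstance Bool Bool) (v : Verdict) (t : ℕ) : Set π.Run :=
  {ω | (ω.1, π.stoppedHistory I ω t) ∈ π.announcedBy v t}

theorem measurableSet_announcedRuns (v : Verdict) (t : ℕ) :
    MeasurableSet (π.announcedRuns I v t) :=
  (π.stopped.measurable_seed_history I t) (π.measurableSet_announcedBy v t)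

theorem monotone_announcedRuns (v : Verdict) : Monotone (π.announcedRuns I v) := by
  intro t t' h ω hω
  obtain ⟨k, hk, hv⟩ := (π.mem_announcedBy_iff I v t ω).1 hω
  exact (π.mem_announcedBy_iff I v t' ω).2 ⟨k, hk.trans h, hv⟩

theorem iUnion_announcedRuns (v : Verdict) :
    ⋃ t, π.announcedRuns I v t = {ω | π.announces I v ω} := by
  ext ω
  rw [Set.mem_iUnion]
  change _ ↔ π.announces I v ω
  rw [announces_iff]
  constructor
  · rintro ⟨t, ht⟩
    obtain ⟨k, _, hv⟩ := (π.mem_announcedBy_iff I v t ω).1 ht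
    exact ⟨k, hv⟩
  · rintro ⟨k, hv⟩
    exact ⟨k, (π.mem_announcedBy_iff I v k ω).2 ⟨k, le_rfl, hv⟩⟩

theorem measurableSet_announces (v : Verdict) : MeasurableSet {ω | π.announces I v ω} := by
  rw [← iUnion_announcedRuns]
  exact MeasurableSet.iUnion fun t => π.measurableSet_announcedRuns v t

theorem historyLaw_announcedBy (v : Verdict) (t : ℕ) :
    (π.stopped.historyLaw I t).real (π.announcedBy v t) =
      (π.runLaw I).real (π.announcedRuns I v t) :=
  map_measureReal_apply (π.stopped.measurable_seed_history I t) (π.measurableSet_announcedBy v t)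

/-- An auditor that announces `v` with probability at least `1 - δ` on `I` and at most `δ` on `J`
requests, in the only group in which the instances differ, at least
`confidenceFactor δ / κ` labels in expectation on `I`, where `κ` bounds the divergence of a
label. -/
theorem confidenceFactor_le (hIJ : Comparable I J) {b : Bool} {κ : ℝ} (hκ0 : 0 ≤ κ)
    (hκ : ∀ x a, 0 ≤ ∑ y, I.law.real {(x, a, y)} * (κ * (if a = b ∧ I.classifier (x, a) = false
      then 1 else 0) + Real.log (J.law.real {(x, a, y)} / I.law.real {(x, a, y)})))
    {δ : ℝ} (hδ : 0 < δ) (hδ' : δ < 1 / 2) (v : Verdict)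
    (hI : ENNReal.ofReal (1 - δ) ≤ π.runLaw I {ω | π.announces I v ω})
    (hJ : π.runLaw J {ω | π.announces J v ω} ≤ ENNReal.ofReal δ) :
    ENNReal.ofReal (confidenceFactor δ) ≤
      ENNReal.ofReal κ * ∫⁻ ω, π.groupLabelCount I b ω ∂(π.runLaw I) := by
  have hstep : ∀ t, ENNReal.ofReal
      ((2 * (π.runLaw I).real (π.announcedRuns I v t) - 1) * Real.log ((1 - δ) / δ)) ≤
      ENNReal.ofReal κ * ∫⁻ ω, π.groupLabelCount I b ω ∂(π.runLaw I) := by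
    intro t
    have hq : (π.stopped.historyLaw J t).real (π.announcedBy v t) ≤ δ := by
      rw [historyLaw_announcedBy]
      refine ENNReal.toReal_le_of_le_ofReal hδ.le ((measure_mono ?_).trans hJ)
      rw [← iUnion_announcedRuns]
      exact Set.subset_iUnion _ t
    have h := π.stopped.le_integral_queried hIJ hκ t (π.measurableSet_announcedBy v t) hδ hδ' hq
    rw [historyLaw_announcedBy] at h
    refine (ENNReal.ofReal_le_ofReal h).trans ?_
    rw [ENNReal.ofReal_mul hκ0]
    gcongr
    exact π.ofReal_integral_queried_le b t
  -- The runs announcing `v` by time `t` increase to all runs announcing `v`, while the right side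
  -- of `hstep` does not depend on `t`.
  have hlim : Filter.Tendsto (fun t => (π.runLaw I).real (π.announcedRuns I v t)) Filter.atTop
      (nhds ((π.runLaw I).real {ω | π.announces I v ω})) := by
    rw [← iUnion_announcedRuns]
    exact (ENNReal.tendsto_toReal (measure_ne_top _ _)).comp
      (tendsto_measure_iUnion_atTop (π.monotone_announcedRuns v))
  have hlim' := ENNReal.tendsto_ofReal (((hlim.const_mul 2).sub_const 1).mul_const
    (Real.log ((1 - δ) / δ)))
  refine le_trans ?_ (le_of_tendsto' hlim' hstep)
  refine ENNReal.ofReal_le_ofReal ?_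
  have hp : 1 - δ ≤ (π.runLaw I).real {ω | π.announces I v ω} :=
    (ENNReal.ofReal_le_iff_le_toReal (measure_ne_top _ _)).1 hI
  rw [confidenceFactor, max_eq_left (by linarith)]
  refine mul_le_mul_of_nonneg_right (by linarith) (Real.log_nonneg ?_)
  rw [le_div_iff₀ hδ]
  linarith

theorem announces_injective {v v' : Verdict} {ω : π.Run} (h : π.announces I v ω)
    (h' : π.announces I v' ω) : v = v' := by
  obtain ⟨t, ht, rfl⟩ := h
  obtain ⟨t', ht', rfl⟩ := h'
  obtain rfl : t = t' := by rw [ht] at ht'; exact_mod_cast ht'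
  rfl

theorem announces_le_of_ne {v v' : Verdict} (hv : v ≠ v') {δ : ℝ} (hδ : δ < 1)
    (h : ENNReal.ofReal (1 - δ) ≤ π.runLaw I {ω | π.announces I v ω}) :
    π.runLaw I {ω | π.announces I v' ω} ≤ ENNReal.ofReal δ := by
  have hsub : {ω | π.announces I v' ω} ⊆ {ω | π.announces I v ω}ᶜ :=
    fun ω h1 h2 => hv (π.announces_injective h2 h1)
  refine (measure_mono hsub).trans ?_
  rw [prob_compl_eq_one_sub (π.measurableSet_announces v)]
  refine (tsub_le_tsub_left h 1).trans ?_
  rw [← ENNReal.ofReal_one, ← ENNReal.ofReal_sub _ (by linarith)]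
  exact ENNReal.ofReal_le_ofReal (by linarith)

end Auditor

/-! ### The family of hard instances -/

namespace AuditInstance

/-- The instance with binary features given by point masses, whose classifier returns the
feature. -/
noncomputable def ofMass (m : Bool × Bool × Bool → ℝ) (h0 : ∀ z, 0 ≤ m z) (h1 : ∑ z, m z = 1) :
    AuditInstance Bool Bool where
  law := ∑ z, ENNReal.ofReal (m z) • Measure.dirac z
  isProb := ⟨by
    rw [Measure.finsetSum_apply]
    simp only [Measure.smul_apply, measure_univ, smul_eq_mul, mul_one]
    rw [← ENNReal.ofReal_sum_of_nonneg fun z _ => h0 z, h1, ENNReal.ofReal_one]⟩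
  classifier := Prod.fst
  measurable_classifier := measurable_fst

variable {m : Bool × Bool × Bool → ℝ} {h0 : ∀ z, 0 ≤ m z} {h1 : ∑ z, m z = 1}

theorem ofMass_real (S : Set (Bool × Bool × Bool)) :
    (ofMass m h0 h1).law.real S = ∑ z, S.indicator m z := by
  classical
  rw [measureReal_def, ofMass, Measure.finsetSum_apply,
    ENNReal.toReal_sum fun z _ => by
      rw [Measure.smul_apply]; exact ENNReal.mul_ne_top ENNReal.ofReal_ne_top (measure_ne_top _ _)]
  refine Finset.sum_congr rfl fun z _ => ?_
  rw [Measure.smul_apply, Measure.dirac_apply, smul_eq_mul, ENNReal.toReal_mul,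
    ENNReal.toReal_ofReal (h0 z)]
  by_cases hz : z ∈ S <;> simp [hz]

theorem ofMass_real_singleton (z : Bool × Bool × Bool) :
    (ofMass m h0 h1).law.real {z} = m z := by
  classical
  simp [ofMass_real, Set.indicator_apply]

end AuditInstance

theorem real_cond_apply {Ω : Type*} [MeasurableSpace Ω] (μ : Measure Ω) {s : Set Ω}
    (hs : MeasurableSet s) (t : Set Ω) : (cond μ s).real t = μ.real (s ∩ t) / μ.real s := by
  rw [measureReal_def, cond_apply hs, ENNReal.toReal_mul, ENNReal.toReal_inv, measureReal_def,
    measureReal_def, div_eq_inv_mul]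

/-- The parameters of a family of instances with the same classifier. -/
structure Family where
  (y₀ : Bool)
  (w s ε : ℝ)
  (r : Bool → ℝ)
  w_pos : 0 < w
  w_lt : w < 1
  s_pos : 0 < s
  s_lt : s < 1
  ε_pos : 0 < ε
  ε_lt : ε < 1 / 4
  r_pos : ∀ a, 0 < r a
  r_le : ∀ a, r a / 2 ≤ (1 - s) * (1 - r a)
  ε_le : ∀ a, 8 * ε * r a ≤ (1 - s) * (1 - r a)

namespace Family

variable (P : Family)

/-- `ℙ[A = a]`. -/
def weight (a : Bool) : ℝ := if a then P.w else 1 - P.w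

/-- `ℙ[f = 0, Y ≠ y₀ ∣ A = a]` in the fair instance. -/
def rest (a : Bool) : ℝ := (1 - P.s) * (1 - P.r a)

/-- The point masses of the instance in which, within each group `a`, the mass `e a` is moved from
the label `!y₀` to the label `y₀` among the negatively classified individuals. -/
noncomputable def mass (e : Bool → ℝ) (z : Bool × Bool × Bool) : ℝ :=
  P.weight z.2.1 * if z.1 then (if z.2.2 = P.y₀ then P.r z.2.1 / 2 else P.s * (1 - P.r z.2.1))
    else (if z.2.2 = P.y₀ then P.r z.2.1 / 2 + e z.2.1 else P.rest z.2.1 - e z.2.1)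

/-- The admissible shifts of mass. -/
def Admissible (e : Bool → ℝ) : Prop := ∀ a, 0 ≤ e a ∧ e a ≤ 4 * P.ε * P.r a

theorem weight_pos (a : Bool) : 0 < P.weight a := by
  have := P.w_pos
  have := P.w_lt
  cases a <;> simp [weight] <;> linarith

theorem rest_pos (a : Bool) : 0 < P.rest a := by
  have := P.r_le a
  have := P.r_pos a
  unfold rest
  linarith

theorem r_lt (a : Bool) : P.r a < 1 := by
  have h := P.rest_pos a
  have := P.s_lt
  unfold rest at h
  by_contra hc
  nlinarith

variable {P} {e e' : Bool → ℝ}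

/-- A shift leaves at least half of the mass of the label `!y₀` among the negatives; this is where
`8 ε r ≤ (1 - s) (1 - r)` enters. -/
theorem Admissible.two_mul_le (he : P.Admissible e) (a : Bool) : 2 * e a ≤ P.rest a := by
  have := P.ε_le a
  have := (he a).2
  unfold rest
  linarith

theorem mass_pos (he : P.Admissible e) (z : Bool × Bool × Bool) : 0 < P.mass e z := by
  refine mul_pos (P.weight_pos _) ?_
  have h1 := P.r_pos z.2.1
  have h2 := P.rest_pos z.2.1
  have h3 := he.two_mul_le z.2.1
  have h4 := (he z.2.1).1
  have h5 := mul_pos P.s_pos (sub_pos.2 (P.r_lt z.2.1))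
  split_ifs <;> linarith

theorem sum_mass : ∑ z, P.mass e z = 1 := by
  have h : ∀ y : Bool, ∀ f g : ℝ, (∑ y', if y' = y then f else g) = f + g := by
    intro y f g
    cases y <;> simp [add_comm]
  simp only [Fintype.sum_prod_type, mass, ← Finset.mul_sum, Fintype.sum_bool (f := fun x => ∑ a : Bool, _)]
  simp only [if_true, Bool.false_eq_true, if_false, h]
  simp only [Fintype.sum_bool, weight, rest, if_true, Bool.false_eq_true, if_false]
  ring

/-- The instance with shift `e`. -/
noncomputable def inst (he : P.Admissible e) : AuditInstance Bool Bool :=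
  AuditInstance.ofMass (P.mass e) (fun z => (mass_pos he z).le) sum_mass

variable (he : P.Admissible e)

theorem groupProb_inst (a : Bool) : (inst he).groupProb a = P.weight a := by
  unfold AuditInstance.groupProb AuditInstance.groupEvent inst
  rw [AuditInstance.ofMass_real]
  cases a <;> cases hy : P.y₀ <;>
    simp [Fintype.sum_prod_type, Set.indicator_apply, mass, rest, hy] <;> ring

theorem beta_inst (a : Bool) : (inst he).beta a = P.r a / 2 + P.rest a := by
  have hg := groupProb_inst he a
  unfold AuditInstance.groupProb at hg
  have hw := (P.weight_pos a).ne'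
  unfold AuditInstance.beta
  rw [real_cond_apply _ .of_discrete, hg, div_eq_iff hw]
  unfold AuditInstance.groupEvent AuditInstance.decisionEvent inst
  rw [AuditInstance.ofMass_real]
  cases a <;> cases hy : P.y₀ <;>
    simp [Fintype.sum_prod_type, Set.indicator_apply, mass, hy, AuditInstance.ofMass] <;> ring

theorem real_label_group (y a : Bool) :
    (inst he).law.real ((inst he).groupEvent a ∩ (inst he).labelEvent y) =
      P.weight a * if y = P.y₀ then P.r a + e a else 1 - P.r a - e a := by
  unfold AuditInstance.groupEvent AuditInstance.labelEvent inst
  rw [AuditInstance.ofMass_real]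
  cases a <;> cases y <;> cases hy : P.y₀ <;>
    simp [Fintype.sum_prod_type, Set.indicator_apply, mass, hy, rest] <;> ring

theorem real_positive_label_group (y a : Bool) :
    (inst he).law.real ((inst he).groupEvent a ∩
      ((inst he).decisionEvent true ∩ (inst he).labelEvent y)) =
      P.weight a * if y = P.y₀ then P.r a / 2 else P.s * (1 - P.r a) := by
  unfold AuditInstance.groupEvent AuditInstance.labelEvent AuditInstance.decisionEvent inst
  rw [AuditInstance.ofMass_real]
  cases a <;> cases y <;> cases hy : P.y₀ <;>
    simp [Fintype.sum_prod_type, Set.indicator_apply, mass, hy, AuditInstance.ofMass]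

theorem q_inst (y a : Bool) :
    (inst he).q y a = if y = P.y₀ then P.r a + e a else 1 - P.r a - e a := by
  have hg := groupProb_inst he a
  unfold AuditInstance.groupProb at hg
  unfold AuditInstance.q
  rw [real_cond_apply _ .of_discrete, hg, real_label_group,
    mul_div_cancel_left₀ _ (P.weight_pos a).ne']

theorem p_inst (y a : Bool) :
    (inst he).p y a = if y = P.y₀ then P.r a / 2 else P.s * (1 - P.r a) := by
  have hg := groupProb_inst he a
  unfold AuditInstance.groupProb at hg
  unfold AuditInstance.p
  rw [real_cond_apply _ .of_discrete, hg, real_positive_label_group,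
    mul_div_cancel_left₀ _ (P.weight_pos a).ne']

theorem positiveRate_inst (y a : Bool) :
    (inst he).positiveRate y a = if y = P.y₀ then P.r a / 2 / (P.r a + e a)
      else P.s * (1 - P.r a) / (1 - P.r a - e a) := by
  unfold AuditInstance.positiveRate
  rw [real_cond_apply _ .of_discrete, Set.inter_comm _ ((inst he).groupEvent a), Set.inter_assoc,
    Set.inter_comm _ ((inst he).decisionEvent true), real_positive_label_group, real_label_group,
    mul_div_mul_left _ _ (P.weight_pos a).ne']
  split_ifs <;> rfl

theorem abs_sub_le_eod {A : Type*} [MeasurableSpace A] [Finite A] (I : AuditInstance Bool A)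
    (y : Bool) (a a' : A) : |I.positiveRate y a - I.positiveRate y a'| ≤ I.eod :=
  (le_ciSup (f := fun a' => |I.positiveRate y a - I.positiveRate y a'|)
    (Set.finite_range _).bddAbove a').trans <|
  (le_ciSup (f := fun a => ⨆ a', |I.positiveRate y a - I.positiveRate y a'|)
    (Set.finite_range _).bddAbove a).trans <|
  le_ciSup (f := fun y => ⨆ a, ⨆ a', |I.positiveRate y a - I.positiveRate y a'|)
    (Set.finite_range _).bddAbove y

theorem eod_inst_of_zero (he : P.Admissible 0) : (inst he).eod = 0 := by
  have h : ∀ y a, (inst he).positiveRate y a = if y = P.y₀ then 1 / 2 else P.s := by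
    intro y a
    rw [positiveRate_inst]
    have := (P.r_pos a).ne'
    have := (sub_pos.2 (P.r_lt a)).ne'
    split_ifs
    · simp only [Pi.zero_apply, add_zero]
      field_simp
    · simp only [Pi.zero_apply, sub_zero]
      field_simp
  simp [AuditInstance.eod, h]

/-- The shift multiplies `q` for `y₀` in group `b` by `1 + 4 ε` and keeps `p`, so the rate falls
from `1 / 2` by `2 ε / (1 + 4 ε)`, which exceeds `ε` because `ε < 1 / 4`. -/
theorem lt_eod_inst {b : Bool} (hb : e b = 4 * P.ε * P.r b) (hb' : e (!b) = 0) :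
    P.ε < (inst he).eod := by
  refine lt_of_lt_of_le ?_ (abs_sub_le_eod (inst he) P.y₀ (!b) b)
  rw [positiveRate_inst, positiveRate_inst, if_pos rfl, if_pos rfl, hb, hb']
  have hr := P.r_pos b
  have hr' := P.r_pos (!b)
  have hε := P.ε_pos
  have hε' := P.ε_lt
  have h1 : P.r (!b) / 2 / (P.r (!b) + 0) = 1 / 2 := by
    field_simp
    simp
  have h2 : P.r b / 2 / (P.r b + 4 * P.ε * P.r b) = 1 / (2 * (1 + 4 * P.ε)) := by
    have : 1 + 4 * P.ε ≠ 0 := by positivity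
    have : P.r b + 4 * P.ε * P.r b = P.r b * (1 + 4 * P.ε) := by ring
    rw [this]
    field_simp
  rw [h1, h2]
  refine lt_of_lt_of_le ?_ (le_abs_self _)
  have h3 : 1 / 2 - 1 / (2 * (1 + 4 * P.ε)) = 2 * P.ε / (1 + 4 * P.ε) := by
    field_simp
    ring
  rw [h3, lt_div_iff₀ (by positivity)]
  nlinarith

/-- A shift only moves mass between the two labels of the same features and group. -/
theorem comparable_inst (he' : P.Admissible e') : Comparable (inst he) (inst he') where
  classifier_eq := rfl
  pos_left z := by
    rw [inst, AuditInstance.ofMass_real_singleton]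
    exact mass_pos he z
  pos_right z := by
    rw [inst, AuditInstance.ofMass_real_singleton]
    exact mass_pos he' z
  marginal_eq x a := by
    simp only [inst, AuditInstance.ofMass_real_singleton]
    cases x <;> cases hy : P.y₀ <;> simp [mass, hy] <;> ring

/-! ### Divergence of a label and comparison with the label complexity -/

/-- Up to a constant, the divergence of a label in the group `a`. -/
noncomputable def divergence (P : Family) (a : Bool) : ℝ :=
  96 * P.ε ^ 2 * P.r a / (P.r a / 2 + P.rest a)

theorem divergence_pos (a : Bool) : 0 < P.divergence a := by
  have := P.ε_pos
  have := P.r_pos a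
  have := P.rest_pos a
  unfold divergence
  positivity

theorem mul_log_div_ge {x y : ℝ} (hx : 0 < x) (hy : 0 < y) :
    y - x - (x - y) ^ 2 / y ≤ x * Real.log (y / x) := by
  have h := Real.one_sub_inv_le_log_of_pos (div_pos hy hx)
  rw [inv_div] at h
  have := mul_le_mul_of_nonneg_left h hx.le
  refine le_trans (le_of_eq ?_) this
  field_simp
  ring

/-- Kullback-Leibler is at most chi-square for two-point measures of equal total mass: the linear
terms of `mul_log_div_ge` cancel. -/
theorem divergence_bound {x x' y y' K : ℝ} (hx : 0 < x) (hx' : 0 < x') (hy : 0 < y) (hy' : 0 < y')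
    (hs : x + x' = y + y') (hK : (x - y) ^ 2 * (1 / y + 1 / y') ≤ K) :
    0 ≤ K + x * Real.log (y / x) + x' * Real.log (y' / x') := by
  have h := mul_log_div_ge hx hy
  have h' := mul_log_div_ge hx' hy'
  have e : (x' - y') ^ 2 = (x - y) ^ 2 := by
    have : x' - y' = -(x - y) := by linarith
    rw [this, neg_sq]
  rw [e] at h'
  have : (x - y) ^ 2 * (1 / y + 1 / y') = (x - y) ^ 2 / y + (x - y) ^ 2 / y' := by ring
  linarith

/-- Up to the group weight, the two shifts differ by at most `4 ε r`, and the two label masses are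
at least `r / 2` and `rest / 2 ≥ r / 4`. Chi-square is thus at most `16 ε² r² (2 / r + 4 / r) = 96
ε² r`. -/
theorem divergence_le (he : P.Admissible e) (he' : P.Admissible e') (a : Bool) :
    0 ≤ P.divergence a * (P.weight a * (P.r a / 2 + P.rest a)) +
      P.weight a * (P.r a / 2 + e a) * Real.log
        (P.weight a * (P.r a / 2 + e' a) / (P.weight a * (P.r a / 2 + e a))) +
      P.weight a * (P.rest a - e a) * Real.log
        (P.weight a * (P.rest a - e' a) / (P.weight a * (P.rest a - e a))) := by
  have hw := P.weight_pos a
  have hr := P.r_pos a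
  have hR := P.rest_pos a
  have hrR : P.r a / 2 ≤ P.rest a := P.r_le a
  have hε := P.ε_pos
  obtain ⟨h1, h2⟩ := he a
  obtain ⟨h1', h2'⟩ := he' a
  have h3 := he.two_mul_le a
  have h3' := he'.two_mul_le a
  refine divergence_bound (by positivity) (mul_pos hw (by linarith)) (by positivity)
    (mul_pos hw (by linarith)) (by ring) ?_
  have hK : P.divergence a * (P.weight a * (P.r a / 2 + P.rest a)) =
      96 * P.ε ^ 2 * P.r a * P.weight a := by
    unfold divergence
    field_simp
  have hsq : (e a - e' a) ^ 2 ≤ (4 * P.ε * P.r a) ^ 2 :=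
    sq_le_sq' (by linarith) (by linarith)
  have hA : 1 / (P.weight a * (P.r a / 2 + e' a)) ≤ 1 / (P.weight a * (P.r a / 2)) :=
    one_div_le_one_div_of_le (by positivity) (by gcongr; linarith)
  have hB : 1 / (P.weight a * (P.rest a - e' a)) ≤ 1 / (P.weight a * (P.r a / 4)) :=
    one_div_le_one_div_of_le (by positivity) (by gcongr; linarith)
  rw [hK]
  calc _ = P.weight a ^ 2 * (e a - e' a) ^ 2 * (1 / (P.weight a * (P.r a / 2 + e' a)) +
        1 / (P.weight a * (P.rest a - e' a))) := by ring
    _ ≤ P.weight a ^ 2 * (4 * P.ε * P.r a) ^ 2 *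
        (1 / (P.weight a * (P.r a / 2)) + 1 / (P.weight a * (P.r a / 4))) :=
      mul_le_mul (by gcongr) (add_le_add hA hB)
        (add_nonneg (by positivity) (one_div_nonneg.2 (mul_pos hw (by linarith)).le))
        (by positivity)
    _ = _ := by
      field_simp
      ring

/-- Outside the negatives of group `b` the two instances have the same point masses, so the
logarithms vanish. -/
theorem divergence_inst (he : P.Admissible e) (he' : P.Admissible e') {b : Bool}
    (hb : ∀ a, a ≠ b → e a = e' a) (x a : Bool) :
    0 ≤ ∑ y, (inst he).law.real {(x, a, y)} * (P.divergence b *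
      (if a = b ∧ (inst he).classifier (x, a) = false then 1 else 0) +
      Real.log ((inst he').law.real {(x, a, y)} / (inst he).law.real {(x, a, y)})) := by
  have hd := (comparable_inst he he').pos_left
  have hne : ∀ y, (inst he).law.real {(x, a, y)} ≠ 0 := fun y => (hd _).ne'
  by_cases h : a = b ∧ x = false
  · obtain ⟨rfl, rfl⟩ := h
    have hk := divergence_le he he' a
    have hc : (inst he).classifier (false, a) = false := rfl
    simp only [hc, and_self, if_true]
    simp only [inst, AuditInstance.ofMass_real_singleton, mass]
    cases hy : P.y₀ <;> simp only [Fintype.sum_bool, if_true, if_false, Bool.false_eq_true,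
      Bool.true_eq_false, mul_one] <;> linarith
  · have heq : ∀ y, (inst he').law.real {(x, a, y)} = (inst he).law.real {(x, a, y)} := by
      intro y
      simp only [inst, AuditInstance.ofMass_real_singleton, mass]
      by_cases hab : a = b
      · have : x = true := by simpa [hab] using h
        simp [this]
      · simp only [hb a hab]
    have h' : ¬ (a = b ∧ (inst he).classifier (x, a) = false) := h
    refine Finset.sum_nonneg fun y _ => ?_
    rw [heq, div_self (hne y), if_neg h']
    simp

/-- The label probabilities are at least `r` and `r / 4`, so the sum is at most `5 β / (r ε²)`, and
`5 * 96 = 480`. -/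
theorem groupComplexity_le (he : P.Admissible e) (a : Bool) :
    (inst he).groupComplexity P.ε a ≤ 480 / P.divergence a := by
  have hε := P.ε_pos
  have hr := P.r_pos a
  have hR := P.rest_pos a
  have hrR : P.r a / 2 ≤ P.rest a := P.r_le a
  have hR1 : P.rest a ≤ 1 - P.r a := by
    have := P.s_pos
    have := P.r_lt a
    unfold rest
    nlinarith
  have h1 := (he a).1
  have h3 := he.two_mul_le a
  set β := P.r a / 2 + P.rest a with hβ
  have hβ0 : 0 < β := by positivity
  have hsum : (inst he).groupComplexity P.ε a =
      β / ((P.r a + e a) * P.ε ^ 2) + β / ((1 - P.r a - e a) * P.ε ^ 2) := by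
    unfold AuditInstance.groupComplexity
    simp only [beta_inst, q_inst, ← hβ]
    cases P.y₀ <;> simp [add_comm]
  have hA : β / ((P.r a + e a) * P.ε ^ 2) ≤ β / (P.r a * P.ε ^ 2) :=
    div_le_div_of_nonneg_left hβ0.le (by positivity) (by gcongr; linarith)
  have hB : β / ((1 - P.r a - e a) * P.ε ^ 2) ≤ β / (P.r a / 4 * P.ε ^ 2) :=
    div_le_div_of_nonneg_left hβ0.le (by positivity) (by gcongr; linarith)
  rw [hsum]
  refine (add_le_add hA hB).trans (le_of_eq ?_)
  unfold divergence
  rw [← hβ]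
  field_simp
  ring

end Family

/-! ### Lower bounds on the hard instances -/

theorem confidenceFactor_nonneg {δ : ℝ} (hδ : 0 < δ) : 0 ≤ confidenceFactor δ := by
  unfold confidenceFactor
  rcases le_total (1 / 2) δ with h | h
  · rw [max_eq_right (by linarith), zero_mul]
  · refine mul_nonneg (le_max_right _ _) (Real.log_nonneg ?_)
    rw [le_div_iff₀ hδ]
    linarith

theorem Family.le_groupLabelCount {P : Family} {e e' : Bool → ℝ} (he : P.Admissible e)
    (he' : P.Admissible e') {b : Bool} (hb : ∀ a, a ≠ b → e a = e' a) {δ : ℝ} (hδ : 0 < δ)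
    (π : Auditor Bool Bool) {v v' : Verdict} (hv : v' ≠ v)
    (hI : ENNReal.ofReal (1 - δ) ≤ π.runLaw (inst he) {ω | π.announces (inst he) v ω})
    (hJ : ENNReal.ofReal (1 - δ) ≤ π.runLaw (inst he') {ω | π.announces (inst he') v' ω}) :
    ENNReal.ofReal (confidenceFactor δ / P.divergence b) ≤
      ∫⁻ ω, π.groupLabelCount (inst he) b ω ∂(π.runLaw (inst he)) := by
  rcases le_or_gt (1 / 2) δ with h | h
  · have : confidenceFactor δ = 0 := by
      unfold confidenceFactor
      rw [max_eq_right (by linarith), zero_mul]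
    simp [this]
  · have hd := P.divergence_pos b
    have key := π.confidenceFactor_le (comparable_inst he he') hd.le (divergence_inst he he' hb)
      hδ h v hI (π.announces_le_of_ne hv (by linarith) hJ)
    rw [ENNReal.ofReal_div_of_pos hd]
    exact ENNReal.div_le_of_le_mul' key

namespace Family

theorem admissible_zero (P : Family) : P.Admissible 0 := fun a =>
  ⟨le_rfl, by have := P.ε_pos; have := P.r_pos a; simp only [Pi.zero_apply]; positivity⟩

/-- The shift by which the unfair instance for the group `b` differs from the fair instance. -/
noncomputable def shift (P : Family) (b a : Bool) : ℝ := if a = b then 4 * P.ε * P.r a else 0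

theorem admissible_shift (P : Family) (b : Bool) : P.Admissible (P.shift b) := fun a => by
  have := P.ε_pos
  have := P.r_pos a
  unfold shift
  split_ifs
  · exact ⟨by positivity, le_rfl⟩
  · exact ⟨le_rfl, by positivity⟩

theorem shift_eq_zero (P : Family) (b a : Bool) (h : a ≠ b) : P.shift b a = 0 := if_neg h

/-- The fair instance. -/
noncomputable def fairInstance (P : Family) : AuditInstance Bool Bool := inst P.admissible_zero

/-- The unfair instance for the group `b`. -/
noncomputable def unfairInstance (P : Family) (b : Bool) : AuditInstance Bool Bool :=
  inst (P.admissible_shift b)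

theorem lt_eod_unfairInstance (P : Family) (b : Bool) : P.ε < (P.unfairInstance b).eod :=
  lt_eod_inst _ (if_pos rfl) (P.shift_eq_zero b _ (by cases b <;> decide))

variable (P : Family) {δ : ℝ} (π : Auditor Bool Bool)

theorem le_groupLabelCount_fair (hδ : 0 < δ) (hF : π.SucceedsOn P.fairInstance P.ε δ) (b : Bool)
    (hU : π.SucceedsOn (P.unfairInstance b) P.ε δ) :
    ENNReal.ofReal (confidenceFactor δ / P.divergence b) ≤
      ∫⁻ ω, π.groupLabelCount P.fairInstance b ω ∂(π.runLaw P.fairInstance) :=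
  le_groupLabelCount P.admissible_zero (P.admissible_shift b)
    (fun a ha => (P.shift_eq_zero b a ha).symm) hδ π (v := .fair) (v' := .unfair) (by simp)
    (hF.1 (eod_inst_of_zero _)) (hU.2 (P.lt_eod_unfairInstance b))

theorem le_expectedLabels_unfair (hδ : 0 < δ) (hF : π.SucceedsOn P.fairInstance P.ε δ) (b : Bool)
    (hU : π.SucceedsOn (P.unfairInstance b) P.ε δ) :
    ENNReal.ofReal (confidenceFactor δ / P.divergence b) ≤
      π.expectedLabels (P.unfairInstance b) :=
  (le_groupLabelCount (P.admissible_shift b) P.admissible_zero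
    (fun a ha => P.shift_eq_zero b a ha) hδ π (v := .unfair) (v' := .fair) (by simp)
    (hU.2 (P.lt_eod_unfairInstance b)) (hF.1 (eod_inst_of_zero _))).trans
    (lintegral_mono fun ω => π.groupLabelCount_le b ω)

/-- The two unfair alternatives force requests in different groups, so no label is counted twice. -/
theorem le_expectedLabels_fair (hδ : 0 < δ) (hF : π.SucceedsOn P.fairInstance P.ε δ)
    (hU : ∀ b, π.SucceedsOn (P.unfairInstance b) P.ε δ) :
    ENNReal.ofReal (∑ b, confidenceFactor δ / P.divergence b) ≤
      π.expectedLabels P.fairInstance := by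
  rw [ENNReal.ofReal_sum_of_nonneg fun b _ =>
    div_nonneg (confidenceFactor_nonneg hδ) (P.divergence_pos b).le, Fintype.sum_bool, add_comm]
  refine (add_le_add (P.le_groupLabelCount_fair π hδ hF false (hU false))
    (P.le_groupLabelCount_fair π hδ hF true (hU true))).trans ((le_lintegral_add _ _).trans
      (lintegral_mono fun ω => (π.groupLabelCount_add ω).le))

end Family

end FairnessAudit

theorem theorem3 :
    ∃ c : ℝ, 0 < c ∧ ∀ ε δ : ℝ, 0 < ε → ε < 1 / 4 → 0 < δ → δ < 1 →
    -- parameters of the family: two groups, one label `y₀`, group probability `w`,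
    -- `r a = ℙ[Y = y₀ ∣ A = a]` and `s = ℙ[f = 1 ∣ Y ≠ y₀]` in the fair instance
    ∀ (y₀ : Bool) (w s : ℝ) (r : Bool → ℝ), 0 < w → w < 1 → 0 < s → s < 1 →
      (∀ a, 0 < r a ∧ r a / 2 ≤ (1 - s) * (1 - r a) ∧ 8 * ε * r a ≤ (1 - s) * (1 - r a)) →
    ∃ (F : FairnessAudit.AuditInstance Bool Bool)
      (U : Bool → FairnessAudit.AuditInstance Bool Bool),
      -- a fair instance
      F.eod = 0 ∧ F.groupProb true = w ∧
      (∀ a, F.q y₀ a = r a ∧ F.p y₀ a = r a / 2 ∧ F.p (!y₀) a = s * (1 - r a) ∧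
        F.beta a = 1 - r a / 2 - s * (1 - r a)) ∧
      -- for each group `b`, an unfair instance with the same classifier that differs in group `b`
      (∀ b, ε < (U b).eod ∧ (U b).classifier = F.classifier ∧ (U b).groupProb true = w ∧
        ∀ a, (U b).q y₀ a = (if a = b then r a * (1 + 4 * ε) else r a) ∧
          (∀ y, (U b).p y a = F.p y a) ∧ (U b).beta a = F.beta a) ∧
      -- every auditor that succeeds on these instances requests many labels on each of them
      ∀ π : FairnessAudit.Auditor Bool Bool,
        π.expectedTime F < ⊤ → (∀ b, π.expectedTime (U b) < ⊤) →
        π.SucceedsOn F ε δ → (∀ b, π.SucceedsOn (U b) ε δ) →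
        ENNReal.ofReal (c * FairnessAudit.confidenceFactor δ * F.labelComplexity ε)
            ≤ π.expectedLabels F ∧
        (∀ b, ENNReal.ofReal
              (c * FairnessAudit.confidenceFactor δ * (U b).groupComplexity ε b)
            ≤ π.expectedLabels (U b)) ∧
        (r false = r true →
          ∀ b, ENNReal.ofReal (c * FairnessAudit.confidenceFactor δ * (U b).labelComplexity ε)
            ≤ π.expectedLabels (U b)) := by
  -- Since `480 / 1000 ≤ 1 / 2`, the share of each group costs at most half of `Λ / divergence`; the
  -- half is needed when `r false = r true`.
  refine ⟨1 / 1000, by norm_num, ?_⟩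
  intro ε δ hε hε' hδ hδ' y₀ w s r hw hw' hs hs' hr
  let P : FairnessAudit.Family :=
    { y₀ := y₀, w := w, s := s, ε := ε, r := r, w_pos := hw, w_lt := hw', s_pos := hs,
      s_lt := hs', ε_pos := hε, ε_lt := hε', r_pos := fun a => (hr a).1,
      r_le := fun a => (hr a).2.1, ε_le := fun a => (hr a).2.2 }
  have hy : (!y₀) ≠ y₀ := by cases y₀ <;> decide
  have hβ : ∀ a, r a / 2 + P.rest a = 1 - r a / 2 - s * (1 - r a) := fun a => by
    simp only [FairnessAudit.Family.rest, P]
    ring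
  refine ⟨P.fairInstance, P.unfairInstance, FairnessAudit.Family.eod_inst_of_zero _,
    FairnessAudit.Family.groupProb_inst _ true, fun a => ⟨?_, ?_, ?_, ?_⟩,
    fun b => ⟨P.lt_eod_unfairInstance b, rfl, FairnessAudit.Family.groupProb_inst _ true,
      fun a => ⟨?_, fun y => ?_, ?_⟩⟩, fun π _ _ hF hU => ?_⟩
  · exact (FairnessAudit.Family.q_inst _ y₀ a).trans (by simp [P])
  · exact (FairnessAudit.Family.p_inst _ y₀ a).trans (if_pos rfl)
  · exact (FairnessAudit.Family.p_inst _ (!y₀) a).trans (if_neg hy)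
  · exact (FairnessAudit.Family.beta_inst _ a).trans (hβ a)
  · refine (FairnessAudit.Family.q_inst _ y₀ a).trans ((if_pos rfl).trans ?_)
    simp only [FairnessAudit.Family.shift, P]
    split_ifs <;> ring
  · exact (FairnessAudit.Family.p_inst _ y a).trans (FairnessAudit.Family.p_inst _ y a).symm
  · exact (FairnessAudit.Family.beta_inst _ a).trans (FairnessAudit.Family.beta_inst _ a).symm
  · have hΛ := FairnessAudit.confidenceFactor_nonneg hδ
    set Λ := FairnessAudit.confidenceFactor δ
    have hd := P.divergence_pos
    have hc : ∀ (e : Bool → ℝ) (he : P.Admissible e) (a : Bool),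
        1 / 1000 * Λ * (FairnessAudit.Family.inst he).groupComplexity ε a ≤
          (Λ / P.divergence a) / 2 := fun e he a => by
      have h := mul_le_mul_of_nonneg_left (FairnessAudit.Family.groupComplexity_le he a) hΛ
      have h0 := div_nonneg hΛ (hd a).le
      rw [← mul_div_assoc, mul_comm Λ 480, mul_div_assoc] at h
      change Λ * (FairnessAudit.Family.inst he).groupComplexity ε a ≤ _ at h
      linarith
    refine ⟨?_, fun b => ?_, fun hrr b => ?_⟩
    · refine le_trans (ENNReal.ofReal_le_ofReal ?_) (P.le_expectedLabels_fair π hδ hF hU)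
      rw [FairnessAudit.AuditInstance.labelComplexity, Finset.mul_sum]
      exact Finset.sum_le_sum fun a _ => (hc _ P.admissible_zero a).trans
        (half_le_self (div_nonneg hΛ (hd a).le))
    · exact (ENNReal.ofReal_le_ofReal ((hc _ (P.admissible_shift b) b).trans
        (half_le_self (div_nonneg hΛ (hd b).le)))).trans
        (P.le_expectedLabels_unfair π hδ hF b (hU b))
    · refine le_trans (ENNReal.ofReal_le_ofReal ?_) (P.le_expectedLabels_unfair π hδ hF b (hU b))
      -- With equal `r` the other group's share is also at most half of the bound coming from group
      -- `b`.
      have hdd : ∀ a, P.divergence a = P.divergence b := fun a => by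
        have : r a = r b := by cases a <;> cases b <;> simp [hrr]
        simp only [FairnessAudit.Family.divergence, FairnessAudit.Family.rest, P, this]
      rw [FairnessAudit.AuditInstance.labelComplexity, Finset.mul_sum, Fintype.sum_bool]
      have h1 := hc _ (P.admissible_shift b) true
      have h2 := hc _ (P.admissible_shift b) false
      rw [hdd] at h1 h2
      exact (add_le_add h1 h2).trans (add_halves _).le
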